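/- **Setting.** Fix a constant $c\in(0,1]$. For $t\ge 0$ there are $n=2t+1+\lceil ct\rceil$ processes $P_1,\dots,P_n$, of which a set of $f\le t$ processes is faulty (Byzantine); let $t_o=\lfloor ct\rfloor$. Computation proceeds in synchronous rounds over authenticated reliable links: a message sent at the beginning of a round is received, with its true sender, by the end of the round. Faulty processes may send any messages (even depending on the messages of the current round), but cannot forge signatures: a partial signature of a correct process occurs in a message of a faulty process only if the correct process has itself already sent it. Values form a totally ordered set with least element $v_{\min}$ and greatest element $v_{\max}$. A $(t+1)$-threshold signature on $m$ is obtained by combining partial signatures on $m$ of at least $t+1$ processes; incorrectly signed messages are ignored. A message costs one word plus one word for each value and each signature in it. The word complexity with $f$ faults is the supremum, over all executions with exactly $f$ faulty processes, of the total number of words sent by correct processes. **Certificates.** A certificate is valid for $v$ if it is a $(t+1)$-threshold signature on $v$, or one on the string "any value", or a list of $k$ groups $(x_i,y_i,\sigma_i)$ with $1\le k\le 5$, $x_i<y_i$, $x_1=v_{\min}$, $y_{i-1}=x_i$, $y_k=v_{\max}$, where $\sigma_i$ is a $(t+1)$-threshold signature on $(x_i,y_i)$. **BUCKET.** It has $t_o+1$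 iterations of six rounds; the $j$-th has leader $L=P_j$. Each process keeps its latest acquired pair (value, valid certificate), if any. (1) A process without a certificate sends AID_REQ to $L$; if it is $L$, it sends it to all processes. (2) A process that received AID_REQ from $L$ *participates* in this iteration and sends $L$ its proposal with a partial signature on it (DISCLOSE). If $L$ received no AID_REQ from itself, it replies with its pair (AID_REPLY) to every process from which it received AID_REQ. (3) If $L$ participates and some value was disclosed by at least $t+1$ processes, $L$ combines the signatures and broadcasts the value with this certificate; otherwise, if at least $n-t_o$ processes disclosed, $L$ broadcasts a list of consecutive groups $[x,y)$ from $v_{\min}$ to $v_{\max}$ such that the disclosed values of at most $t$ processes fall into each group and those of at least $t+1$ processes fall into any two adjacent groups. A non-participating process that received a valid pair in an AID_REPLY from $L$ acquires it. (4) A participant that received from $L$ a list of at most $5$ groups sends $L$ a partial signature on every group that does not contain its proposal. (5) If $L$ participates, has formed groups, has broadcast no certificate in this iteration, and received partial signatures from at least $t+1$ processes for every group, it combines them and broadcasts the resulting certificate for a fixed default value. (6) A participant that received from $L$ a valid pair in such a certificate broadcast acquires it; otherwise it keeps what it had. **STRONG.** All processes first run BUCKET with their proposals. Then, in four rounds: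 (1) a process without a certificate broadcasts HELP_REQ; (2) every process answers each sender of HELP_REQ with a HELP_REPLY that contains its acquired pair (if any) and a partial signature on its own proposal; (3) a process without a certificate acquires a valid pair from a HELP_REPLY, if there is one; otherwise, if for some $v$ it received partial signatures on $v$ from at least $t+1$ processes, it combines them, acquires the resulting pair and broadcasts it (FINAL_CERTIFICATE); otherwise it broadcasts a partial signature on "any value" (ALLOW-ANY); (4) a process still without a certificate acquires a valid pair from a FINAL_CERTIFICATE message, if there is one; otherwise it takes its own proposal together with the combination of the received ALLOW-ANY signatures. Then all processes propose their pairs to an EBA protocol (Byzantine agreement with external validity, whose own signatures use separate keys) and decide the value decided there. In the *relaying* variant a process that acquires a pair from a HELP_REPLY in round (3) also broadcasts it as FINAL_CERTIFICATE. **Theorem.** For every $c\in(0,1]$ and every $K\in\mathbb N$ there is a constant $C$ such that the following holds for all $t\ge0$, all sets of values and all default values. Let EBA be any protocol for $n$ processes in which correct processes send at most $K\,n\,(f+1)$ words in every execution with $f\le t$ faults where all correct processes propose valid pairs. For STRONG without relaying, assume moreover that in EBA correct processes send at most $K\,n^2$ words in every execution with $f\le t$ faults, whatever is proposed (this is not needed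 for the relaying variant). Then, for every $f\le t$, the word complexity of STRONG with $f$ faults is at most $C\,n\,(f+1)$; that is, STRONG achieves $O(n\cdot f)$ word complexity (with $f$ read as $f+1$, so that $f=0$ is covered). -/

import Mathlib

namespace SBA

universe u

/-! ## Signatures

Signatures are ideal. A partial signature records its signer and the signed content; a threshold
signature records the content and the set of processes whose partial signatures were combined.
Unforgeability is a condition on executions (see `Execution.unforgeable`). -/

/-- A partial signature on `content`, produced with the private key of `signer`. -/
structure PSig (n : ℕ) (C : Type u) where
  signer : Fin n
  content : C

/-- A threshold signature on `content`, combined from the partial signatures of `signers`. -/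
structure TSig (n : ℕ) (C : Type u) where
  content : C
  signers : Finset (Fin n)

/-- `ShareSign_i(m)`. -/
def shareSign {n : ℕ} {C : Type u} (i : Fin n) (m : C) : PSig n C := ⟨i, m⟩

/-- `ShareVerify_i(m, s)`. -/
def ShareVerify {n : ℕ} {C : Type u} (i : Fin n) (m : C) (s : PSig n C) : Prop :=
  s = shareSign i m

/-- `Combine` applied to the partial signatures of `m` by the processes in `S`. -/
def combine {n : ℕ} {C : Type u} (m : C) (S : Finset (Fin n)) : TSig n C := ⟨m, S⟩

/-- `CombinedVerify^k(m, s)`. -/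
def CombinedVerify {n : ℕ} {C : Type u} (k : ℕ) (m : C) (s : TSig n C) : Prop :=
  s.content = m ∧ k ≤ s.signers.card

/-- The partial signatures contained in a threshold signature. -/
def TSig.shares {n : ℕ} {C : Type u} (s : TSig n C) : Set (PSig n C) :=
  {p | p.content = s.content ∧ p.signer ∈ s.signers}

/-! ## Synchronous round-based protocols and their executions -/

/-- A synchronous protocol for `n` processes. In each round every process sends, to every process,
a list of messages that depends on its state, and then updates its state from the messages received
in this round. `words m` is the number of words of `m`, and `shares m` is the set of the partial
signatures that `m` contains (directly, or inside a threshold signature). -/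
structure Protocol (n : ℕ) (In Out : Type u) where
  State : Type u
  Msg : Type u
  Content : Type u
  start : Fin n → In → State
  send : Fin n → State → Fin n → List Msg
  recv : Fin n → State → (Fin n → List Msg) → State
  output : Fin n → State → Option Out
  words : Msg → ℕ
  one_le_words : ∀ m, 1 ≤ words m
  shares : Msg → Set (PSig n Content)

/-- An execution in which `B` is the set of faulty (Byzantine) processes.  `sent r i j` is the list
of the messages that `i` sends to `j` in round `r`; they are received by the end of round `r`.
Correct processes follow the protocol. Faulty processes send arbitrary messages, possibly depending
on everything sent up to and including the current round, except that they cannot forge signatures: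
a partial signature of a correct process occurs in their messages only if that process has itself
sent it by then. -/
structure Execution {n : ℕ} {In Out : Type u} (P : Protocol n In Out) (B : Finset (Fin n)) where
  input : Fin n → In
  state : ℕ → Fin n → P.State
  sent : ℕ → Fin n → Fin n → List P.Msg
  state_zero : ∀ i, i ∉ B → state 0 i = P.start i (input i)
  sent_correct : ∀ r i, i ∉ B → ∀ j, sent r i j = P.send i (state r i) j
  state_succ : ∀ r i, i ∉ B → state (r + 1) i = P.recv i (state r i) (fun j => sent r j i)
  unforgeable : ∀ r i, i ∈ B → ∀ j, ∀ m ∈ sent r i j, ∀ s ∈ P.shares m, s.signer ∉ B →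
    ∃ r' ≤ r, ∃ j', ∃ m' ∈ sent r' s.signer j', s ∈ P.shares m'

/-- The number of words sent by correct processes in rounds `0, …, R - 1`. -/
def Execution.wordsBefore {n : ℕ} {In Out : Type u} {P : Protocol n In Out} {B : Finset (Fin n)}
    (α : Execution P B) (R : ℕ) : ℕ :=
  ∑ r ∈ Finset.range R, ∑ i ∈ Bᶜ, ∑ j, ((α.sent r i j).map P.words).sum

/-- The number of words sent by correct processes in the whole execution (`⊤` if infinite). -/
noncomputable def Execution.wordComplexity {n : ℕ} {In Out : Type u} {P : Protocol n In Out}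
    {B : Finset (Fin n)} (α : Execution P B) : ℕ∞ :=
  ⨆ R : ℕ, (α.wordsBefore R : ℕ∞)

/-- The word complexity of a protocol with `f` actual faults: the supremum of the word complexity
over all executions with exactly `f` faulty processes in which the input of every correct process
satisfies `Legal`. -/
noncomputable def Protocol.wordComplexity {n : ℕ} {In Out : Type u} (P : Protocol n In Out)
    (Legal : In → Prop) (f : ℕ) : ℕ∞ :=
  ⨆ (B : Finset (Fin n)) (_ : B.card = f) (α : Execution P B)
    (_ : ∀ i, i ∉ B → Legal (α.input i)), α.wordComplexity

/-! ## Certificates -/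

/-- What processes sign in BUCKET and in STRONG: a value, the string "any value", or a group. -/
inductive Content (V : Type u) where
  | value (v : V)
  | anyValue
  | group (x y : V)

/-- A certificate is a single threshold signature (on a value: a positive bucket certificate or a
specific certificate; on "any value": a general certificate), or a list of signed groups
`(x, y, σ)` (a negative bucket certificate). -/
inductive Certificate (n : ℕ) (V : Type u) where
  | single (s : TSig n (Content V))
  | negative (gs : List (V × V × TSig n (Content V)))

/-- The maximal number of groups that is accepted in a partition and in a certificate. -/
def maxGroups : ℕ := 5

/-- `gs = [(x₁, y₁), …, (x_k, y_k)]` is a chain of groups from the least to the greatest value: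
`k > 0`, `x_i < y_i`, `y_{i-1} = x_i`, `x₁ = v_min` and `y_k = v_max`. -/
def IsGroupChain {V : Type u} [LinearOrder V] [BoundedOrder V] (gs : List (V × V)) : Prop :=
  (∀ g ∈ gs, g.1 < g.2) ∧
  gs.IsChain (fun g g' => g.2 = g'.1) ∧
  gs.head?.map Prod.fst = some ⊥ ∧
  gs.getLast?.map Prod.snd = some ⊤

/-- `validate(v, Σ) = true`. -/
def Valid {n : ℕ} {V : Type u} [LinearOrder V] [BoundedOrder V] (t : ℕ) :
    V × Certificate n V → Prop
  | (v, .single s) =>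
      CombinedVerify (t + 1) (.value v) s ∨ CombinedVerify (t + 1) .anyValue s
  | (_, .negative gs) =>
      gs.length ≤ maxGroups ∧
      IsGroupChain (gs.map fun g => (g.1, g.2.1)) ∧
      ∀ g ∈ gs, CombinedVerify (t + 1) (.group g.1 g.2.1) g.2.2

/-- The number of values and signatures in a certificate. -/
def Certificate.words {n : ℕ} {V : Type u} : Certificate n V → ℕ
  | .single _ => 1
  | .negative gs => 3 * gs.length

/-- The partial signatures contained in a certificate. -/
def Certificate.shares {n : ℕ} {V : Type u} : Certificate n V → Set (PSig n (Content V))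
  | .single s => s.shares
  | .negative gs => {p | ∃ g ∈ gs, p ∈ g.2.2.shares}

/-! ## Messages of BUCKET and STRONG -/

inductive Msg (n : ℕ) (V : Type u) where
  | aidReq
  | aidReply (c : Option (V × Certificate n V))
  | disclose (v : V) (sig : PSig n (Content V))
  | partitionReq (groups : List (V × V))
  | partitionReply (negatives : List ((V × V) × PSig n (Content V)))
  | certificate (c : V × Certificate n V)
  | helpReq
  | helpReply (c : Option (V × Certificate n V)) (sig : PSig n (Content V))
  | finalCertificate (c : V × Certificate n V)
  | allowAny (sig : PSig n (Content V))

/-- Words of an optional value-certificate pair. -/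
def pairWords {n : ℕ} {V : Type u} : Option (V × Certificate n V) → ℕ
  | none => 0
  | some c => 1 + c.2.words

/-- Partial signatures in an optional value-certificate pair. -/
def pairShares {n : ℕ} {V : Type u} : Option (V × Certificate n V) → Set (PSig n (Content V))
  | none => ∅
  | some c => c.2.shares

/-- One word for the kind of the message and one for each value and each signature in it. -/
def Msg.words {n : ℕ} {V : Type u} : Msg n V → ℕ
  | .aidReq => 1
  | .aidReply c => 1 + pairWords c
  | .disclose _ _ => 1 + 2
  | .partitionReq gs => 1 + 2 * gs.length
  | .partitionReply ns => 1 + 3 * ns.length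
  | .certificate c => 1 + pairWords (some c)
  | .helpReq => 1
  | .helpReply c _ => 1 + (pairWords c + 1)
  | .finalCertificate c => 1 + pairWords (some c)
  | .allowAny _ => 1 + 1

theorem Msg.one_le_words {n : ℕ} {V : Type u} (m : Msg n V) : 1 ≤ m.words := by
  cases m <;> simp [Msg.words]

/-- The partial signatures contained in a message. -/
def Msg.shares {n : ℕ} {V : Type u} : Msg n V → Set (PSig n (Content V))
  | .aidReq => ∅
  | .aidReply c => pairShares c
  | .disclose _ s => {s}
  | .partitionReq _ => ∅
  | .partitionReply ns => {p | ∃ g ∈ ns, p = g.2}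
  | .certificate c => c.2.shares
  | .helpReq => ∅
  | .helpReply c s => pairShares c ∪ {s}
  | .finalCertificate c => c.2.shares
  | .allowAny s => {s}

/-! The following functions read the content of a message of a given kind. -/

def Msg.aidReply? {n : ℕ} {V : Type u} : Msg n V → Option (V × Certificate n V)
  | .aidReply c => c
  | _ => none

def Msg.certificate? {n : ℕ} {V : Type u} : Msg n V → Option (V × Certificate n V)
  | .certificate c => some c
  | _ => none

def Msg.helpReply? {n : ℕ} {V : Type u} : Msg n V → Option (V × Certificate n V)
  | .helpReply c _ => c
  | _ => none

def Msg.finalCertificate? {n : ℕ} {V : Type u} : Msg n V → Option (V × Certificate n V)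
  | .finalCertificate c => some c
  | _ => none

def Msg.partitionReq? {n : ℕ} {V : Type u} : Msg n V → Option (List (V × V))
  | .partitionReq gs => some gs
  | _ => none

open scoped Classical in
/-- The disclosed value, if the message is a DISCLOSE message correctly signed by its sender `j`. -/
noncomputable def Msg.disclosed? {n : ℕ} {V : Type u} (j : Fin n) : Msg n V → Option V
  | .disclose v s => if ShareVerify j (.value v) s then some v else none
  | _ => none

open scoped Classical in
/-- The first valid value-certificate pair in a list. -/
noncomputable def firstValid {n : ℕ} {V : Type u} [LinearOrder V] [BoundedOrder V] (t : ℕ)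
    (l : List (V × Certificate n V)) : Option (V × Certificate n V) :=
  l.find? (fun c => decide (Valid t c))

/-- All received messages, from all senders. -/
def allMsgs {n : ℕ} {V : Type u} (inbox : Fin n → List (Msg n V)) : List (Msg n V) :=
  (List.finRange n).flatMap inbox

/-! ## Local state -/

/-- Parameters: the maximal number `t` of faults, the optimistic threshold `tO`, the default value,
and whether a process which in round 3 of the agreement phase acquires a certificate from a
HELP_REPLY message broadcasts it in a FINAL_CERTIFICATE message. -/
structure Config (V : Type u) where
  t : ℕ
  tO : ℕ
  defaultValue : V
  relay : Bool

/-- Local variables of a process outside of EBA. `cert` is the acquired value-certificate pair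
(`none` if `certificate_acquired` is false); `started`, `groups`, `announced` belong to the current
iteration of BUCKET: whether the process has invoked `certificate_creation`, the groups that it has
formed as the leader, and whether it has broadcast a certificate as the leader. `inbox j` holds the
messages received from `j` in the current iteration of BUCKET, resp. in the agreement phase. -/
structure LocalState (n : ℕ) (V : Type u) where
  round : ℕ
  proposal : V
  cert : Option (V × Certificate n V)
  started : Bool
  groups : Option (List (V × V))
  announced : Bool
  inbox : Fin n → List (Msg n V)

/-- The effect of the code of one round: the new variables and the messages sent. -/
abbrev Action (n : ℕ) (V : Type u) := LocalState n V × (Fin n → List (Msg n V))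

def silent {n : ℕ} {V : Type u} : Fin n → List (Msg n V) := fun _ => []

def broadcast {n : ℕ} {V : Type u} (m : Msg n V) : Fin n → List (Msg n V) := fun _ => [m]

def sendTo {n : ℕ} {V : Type u} (L : Fin n) (m : Msg n V) : Fin n → List (Msg n V) :=
  fun j => if j = L then [m] else []

/-! ## BUCKET -/

/-- The value disclosed by each process, if any. -/
noncomputable def disclosures {n : ℕ} {V : Type u} (inbox : Fin n → List (Msg n V)) :
    Fin n → Option V :=
  fun j => (inbox j).findSome? (Msg.disclosed? j)

open scoped Classical in
/-- The processes that have disclosed the value `v`. -/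
noncomputable def disclosers {n : ℕ} {V : Type u} (D : Fin n → Option V) (v : V) :
    Finset (Fin n) :=
  Finset.univ.filter fun j => D j = some v

/-- The number of processes whose disclosed value falls into `g = (x, y)`, i.e. `x ≤ value < y`. -/
noncomputable def groupCount {n : ℕ} {V : Type u} [LinearOrder V] (D : Fin n → Option V)
    (g : V × V) : ℕ :=
  Set.ncard {j : Fin n | ∃ v, D j = some v ∧ g.1 ≤ v ∧ v < g.2}

/-- Requirements on a partition of the disclosed values: the values of at most `t` processes fall
into each group, and those of at least `t + 1` processes into any two adjacent groups. -/
def IsPartition {n : ℕ} {V : Type u} [LinearOrder V] [BoundedOrder V] (t : ℕ)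
    (D : Fin n → Option V) (gs : List (V × V)) : Prop :=
  IsGroupChain gs ∧
  (∀ g ∈ gs, groupCount D g ≤ t) ∧
  gs.IsChain (fun g g' => t + 1 ≤ groupCount D g + groupCount D g')

open scoped Classical in
/-- `partition(discloses)`. -/
noncomputable def partition {n : ℕ} {V : Type u} [LinearOrder V] [BoundedOrder V] (t : ℕ)
    (D : Fin n → Option V) : List (V × V) :=
  if h : ∃ gs, IsPartition t D gs then h.choose else []

open scoped Classical in
/-- The processes from which a correctly signed partial signature of the group `g` is received. -/
noncomputable def groupSigners {n : ℕ} {V : Type u} (inbox : Fin n → List (Msg n V))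
    (g : V × V) : Finset (Fin n) :=
  Finset.univ.filter fun j => ∃ ns s, Msg.partitionReply ns ∈ inbox j ∧ (g, s) ∈ ns ∧
    ShareVerify j (.group g.1 g.2) s

open scoped Classical in
/-- `construct_negative_certificate(replies, groups)`. -/
noncomputable def constructNegative {n : ℕ} {V : Type u} (t : ℕ) (inbox : Fin n → List (Msg n V)) :
    Option (List (V × V)) → Option (Certificate n V)
  | none => none
  | some gs =>
      if ∀ g ∈ gs, t + 1 ≤ (groupSigners inbox g).card then
        some (.negative (gs.map fun g =>
          (g.1, g.2, combine (.group g.1 g.2) (groupSigners inbox g))))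
      else none

open scoped Classical in
/-- Code of process `i` in round `k + 1` (`0 ≤ k ≤ 5`) of the iteration of BUCKET with leader `L`.
Rounds 1, …, 5 of `certificate_creation` are rounds 2, …, 6 of the iteration. -/
noncomputable def bucketRound {n : ℕ} {V : Type u} [LinearOrder V] [BoundedOrder V]
    (cfg : Config V) (L i : Fin n) (k : ℕ) (s : LocalState n V) : Action n V :=
  match k with
  | 0 =>
    if s.cert = none then
      (s, if i = L then broadcast .aidReq else sendTo L .aidReq)
    else (s, silent)
  | 1 =>
    if Msg.aidReq ∈ s.inbox L then
      ({ s with started := true, groups := none, announced := false },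
        sendTo L (.disclose s.proposal (shareSign i (.value s.proposal))))
    else
      ({ s with started := false, groups := none, announced := false },
        if i = L then fun j => if Msg.aidReq ∈ s.inbox j then [.aidReply s.cert] else []
        else silent)
  | 2 =>
    if s.started then
      if i = L then
        let D := disclosures s.inbox
        if h : ∃ v, cfg.t + 1 ≤ (disclosers D v).card then
          ({ s with announced := true },
            broadcast (.certificate
              (h.choose, .single (combine (.value h.choose) (disclosers D h.choose)))))
        else if n - cfg.tO ≤ (Finset.univ.filter fun j => D j ≠ none).card then
          ({ s with groups := some (partition cfg.t D) },
            broadcast (.partitionReq (partition cfg.t D)))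
        else (s, silent)
      else (s, silent)
    else
      match firstValid cfg.t ((s.inbox L).filterMap Msg.aidReply?) with
      | some c => ({ s with cert := some c }, silent)
      | none => (s, silent)
  | 3 =>
    if s.started then
      match ((s.inbox L).filterMap Msg.partitionReq?).find?
          (fun gs => decide (gs.length ≤ maxGroups)) with
      | some gs =>
        (s, sendTo L (.partitionReply
          ((gs.filter fun g => decide (¬ (g.1 ≤ s.proposal ∧ s.proposal < g.2))).map
            fun g => (g, shareSign i (.group g.1 g.2)))))
      | none => (s, silent)
    else (s, silent)
  | 4 =>
    if s.started ∧ i = L ∧ ¬ s.announced then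
      match constructNegative cfg.t s.inbox s.groups with
      | some S => ({ s with announced := true }, broadcast (.certificate (cfg.defaultValue, S)))
      | none => (s, silent)
    else (s, silent)
  | _ =>
    if s.started then
      match firstValid cfg.t ((s.inbox L).filterMap Msg.certificate?) with
      | some c => ({ s with cert := some c }, silent)
      | none => (s, silent)
    else (s, silent)

/-! ## STRONG -/

open scoped Classical in
/-- The processes from which a HELP_REPLY message with a correct partial signature of the value `v`
is received. -/
noncomputable def helpSigners {n : ℕ} {V : Type u} (inbox : Fin n → List (Msg n V)) (v : V) :
    Finset (Fin n) :=
  Finset.univ.filter fun j => ∃ c s, Msg.helpReply c s ∈ inbox j ∧ ShareVerify j (.value v) s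

open scoped Classical in
/-- The processes from which an ALLOW-ANY message with a correct partial signature is received. -/
noncomputable def allowAnySigners {n : ℕ} {V : Type u} (inbox : Fin n → List (Msg n V)) :
    Finset (Fin n) :=
  Finset.univ.filter fun j => ∃ s, Msg.allowAny s ∈ inbox j ∧ ShareVerify j .anyValue s

open scoped Classical in
/-- Code of process `i` in round `k + 1` (`0 ≤ k ≤ 3`) of the agreement phase. After round 4 the
pair `cert` is proposed to EBA. -/
noncomputable def agreementRound {n : ℕ} {V : Type u} [LinearOrder V] [BoundedOrder V]
    (cfg : Config V) (i : Fin n) (k : ℕ) (s : LocalState n V) : Action n V :=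
  match k with
  | 0 => (s, if s.cert = none then broadcast .helpReq else silent)
  | 1 =>
    (s, fun j => if Msg.helpReq ∈ s.inbox j then
      [.helpReply s.cert (shareSign i (.value s.proposal))] else [])
  | 2 =>
    if s.cert = none then
      match firstValid cfg.t ((allMsgs s.inbox).filterMap Msg.helpReply?) with
      | some c =>
        ({ s with cert := some c }, if cfg.relay then broadcast (.finalCertificate c) else silent)
      | none =>
        if h : ∃ v, cfg.t + 1 ≤ (helpSigners s.inbox v).card then
          let c : V × Certificate n V :=
            (h.choose, .single (combine (.value h.choose) (helpSigners s.inbox h.choose)))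
          ({ s with cert := some c }, broadcast (.finalCertificate c))
        else (s, broadcast (.allowAny (shareSign i .anyValue)))
    else (s, silent)
  | 3 =>
    if s.cert = none then
      match firstValid cfg.t ((allMsgs s.inbox).filterMap Msg.finalCertificate?) with
      | some c => ({ s with cert := some c }, silent)
      | none =>
        let c : V × Certificate n V :=
          (s.proposal, .single (combine .anyValue (allowAnySigners s.inbox)))
        ({ s with cert := some c }, silent)
    else (s, silent)
  | _ => (s, silent)

/-- The number of rounds of BUCKET: `tO + 1` iterations of 6 rounds. -/
def bucketLength {V : Type u} (cfg : Config V) : ℕ := 6 * (cfg.tO + 1)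

/-- The first round of EBA. -/
def ebaStart {V : Type u} (cfg : Config V) : ℕ := bucketLength cfg + 4

/-- Code of process `i` in its current round before EBA. In the `j`-th iteration of BUCKET (counted
from 0) the leader is the `j`-th process. -/
noncomputable def localRound {n : ℕ} {V : Type u} [LinearOrder V] [BoundedOrder V]
    (cfg : Config V) (i : Fin n) (s : LocalState n V) : Action n V :=
  if s.round < bucketLength cfg then
    if h : s.round / 6 < n then bucketRound cfg ⟨s.round / 6, h⟩ i (s.round % 6) s
    else (s, silent)
  else agreementRound cfg i (s.round - bucketLength cfg) s

/-- A protocol that can be used for EBA: inputs (proposals) and outputs (decisions) are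
value-certificate pairs. -/
abbrev EBAProtocol (n : ℕ) (V : Type u) :=
  Protocol n (V × Certificate n V) (V × Certificate n V)

/-- STRONG, with `E` as its EBA protocol: BUCKET, then the four rounds of the agreement phase, then
`E` with the acquired pairs as proposals. A new iteration of BUCKET, as well as the agreement phase,
starts with an empty inbox. -/
noncomputable def strong {n : ℕ} {V : Type u} [LinearOrder V] [BoundedOrder V] (cfg : Config V)
    (E : EBAProtocol n V) : Protocol n V V where
  State := LocalState n V × Option E.State
  Msg := Msg n V ⊕ E.Msg
  Content := Content V ⊕ E.Content
  start _ v :=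
    ({ round := 0, proposal := v, cert := none, started := false, groups := none,
       announced := false, inbox := fun _ => [] }, none)
  send i s j :=
    if s.1.round < ebaStart cfg then ((localRound cfg i s.1).2 j).map Sum.inl
    else (s.2.elim [] fun e => E.send i e j).map Sum.inr
  recv i s inb :=
    let s' := (localRound cfg i s.1).1
    ({ s' with
        round := s.1.round + 1,
        inbox := fun j => if (s.1.round + 1) % 6 = 0 then []
          else s.1.inbox j ++ (inb j).filterMap Sum.getLeft? },
      if s.1.round + 1 < ebaStart cfg then none
      else if s.1.round + 1 = ebaStart cfg then s'.cert.map (E.start i)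
      else s.2.map fun e => E.recv i e fun j => (inb j).filterMap Sum.getRight?)
  output i s := (s.2.bind (E.output i)).map Prod.fst
  words := Sum.elim Msg.words E.words
  one_le_words m := by
    cases m with
    | inl m => exact m.one_le_words
    | inr m => exact E.one_le_words m
  shares m := match m with
    | .inl m => Set.image (fun s => ⟨s.signer, .inl s.content⟩) m.shares
    | .inr m => Set.image (fun s => ⟨s.signer, .inr s.content⟩) (E.shares m)

/-- The number `n = 2t + 1 + ⌈c t⌉` of processes. -/
noncomputable def numProcs (c : ℝ) (t : ℕ) : ℕ := 2 * t + 1 + ⌈c * t⌉₊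

/-- The optimistic threshold `t_o = ⌊c t⌋`. -/
noncomputable def optThreshold (c : ℝ) (t : ℕ) : ℕ := ⌊c * t⌋₊

end SBA

/-! The cost is split at `t_o`. Suppose first that `f ≤ t_o`. One of the `t_o + 1` leaders is
correct, and an iteration with a correct leader certifies every correct process. A certified leader
answers all requests. An uncertified one hears from all correct processes, so it either finds a
value disclosed `t + 1` times or partitions the values into groups of at most `t` proposals each. In
the second case all but at most `f + t` processes sign a given group, and `n ≥ 2t + 1 + t_o` leaves
the required `t + 1` signatures (`LocalRun.certified_of_leader_correct`). As `n ≤ 3t + 1`, there are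
at most five groups (`IsPartition.length_le`), so all messages have bounded length.

Traffic in an iteration runs only to and from the leader, hence costs `O(n)`. Once everyone is
certified, a correct leader only answers faulty processes, at cost `O(f)`. Thus at most `f + 1`
iterations cost `O(n)` (`LocalRun.card_busy_le`), and the other at most `n` ones cost `O(f)` each.
In the agreement phase, likewise, only faulty processes get answers, which costs `O(n f)`, and EBA
starts from valid pairs.

If `f > t_o`, then `f > c t`, so `n = O(f + 1)` and even quadratic cost is affordable: all `t_o + 1
≤ f` iterations may cost `O(n)`, and the agreement phase `O(n²)`. Relaying keeps the EBA inputs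
valid (`LocalRun.valid_ebaStart`). Without it a process helped only by faulty ones is silent in
round 3, and another may be left with fewer than `t + 1` ALLOW-ANY signatures; hence the separate
quadratic assumption on EBA.

An execution of STRONG is cut into a `LocalRun` and an execution of EBA (`strongEBA`), and the two
costs are added in `strong_wordComplexity_le`. -/

namespace SBA

universe u

/-! ### Existence and size of partitions of the disclosed values. -/

section Partition

variable {n : ℕ} {V : Type u} [LinearOrder V]

theorem groupCount_add (D : Fin n → Option V) {x y z : V} (hxy : x ≤ y) (hyz : y ≤ z) :
    groupCount D (x, y) + groupCount D (y, z) = groupCount D (x, z) := by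
  unfold groupCount
  rw [← Set.ncard_union_eq _ (Set.toFinite _) (Set.toFinite _)]
  · congr 1
    ext j
    simp only [Set.mem_union, Set.mem_ofPred_eq]
    constructor
    · rintro (⟨v, h, h1, h2⟩ | ⟨v, h, h1, h2⟩)
      · exact ⟨v, h, h1, h2.trans_le hyz⟩
      · exact ⟨v, h, hxy.trans h1, h2⟩
    · rintro ⟨v, h, h1, h2⟩
      rcases lt_or_ge v y with h3 | h3
      · exact .inl ⟨v, h, h1, h3⟩
      · exact .inr ⟨v, h, h3, h2⟩
  · rw [Set.disjoint_left]
    rintro j ⟨v, h, _, h2⟩ ⟨w, h', h3, _⟩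
    rw [h] at h'
    cases h'
    exact absurd h2 (not_lt.2 h3)

theorem groupCount_le (D : Fin n → Option V) (g : V × V) : groupCount D g ≤ n := by
  unfold groupCount
  simpa using Set.ncard_le_card (s := {j : Fin n | ∃ v, D j = some v ∧ g.1 ≤ v ∧ v < g.2})

/-- The number of processes whose disclosed value lies in the closed interval `[x, v]`. -/
noncomputable def closedCount (D : Fin n → Option V) (x v : V) : ℕ :=
  Set.ncard {j : Fin n | ∃ w, D j = some w ∧ x ≤ w ∧ w ≤ v}

/-- The witness is the greatest disclosed value in `[x, y)`. Cut points are sought among the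
finitely many disclosed values because the order on `V` may be dense. -/
theorem exists_closedCount_eq (D : Fin n → Option V) {x y : V} (h : 0 < groupCount D (x, y)) :
    ∃ v, (∃ j, D j = some v) ∧ x ≤ v ∧ v < y ∧ closedCount D x v = groupCount D (x, y) := by
  have hne := (Set.ncard_pos (Set.toFinite _)).1 h
  obtain ⟨j, ⟨v, hj, hxv, hvy⟩, hmax⟩ := Set.exists_max_image
    {j : Fin n | ∃ v, D j = some v ∧ x ≤ v ∧ v < y} (fun j => (D j).getD x)
    (Set.toFinite _) hne
  refine ⟨v, ⟨j, hj⟩, hxv, hvy, ?_⟩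
  unfold closedCount groupCount
  congr 1
  ext k
  simp only [Set.mem_ofPred_eq]
  constructor
  · rintro ⟨w, hk, h1, h2⟩
    exact ⟨w, hk, h1, h2.trans_lt hvy⟩
  · rintro ⟨w, hk, h1, h2⟩
    refine ⟨w, hk, h1, ?_⟩
    have := hmax k ⟨w, hk, h1, h2⟩
    rw [hj, hk] at this
    simpa using this

theorem closedCount_le_groupCount_add (D : Fin n → Option V) (x v y : V) (hvy : v < y) :
    closedCount D x v ≤ groupCount D (x, v) + groupCount D (v, y) := by
  unfold closedCount groupCount
  refine (Set.ncard_le_ncard ?_ (Set.toFinite _)).trans (Set.ncard_union_le _ _)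
  rintro j ⟨w, hj, h1, h2⟩
  rcases h2.lt_or_eq with h3 | rfl
  · exact .inl ⟨w, hj, h1, h3⟩
  · exact .inr ⟨w, hj, le_rfl, hvy⟩

theorem closedCount_le_add_disclosers (D : Fin n → Option V) (x v : V) :
    closedCount D x v ≤ groupCount D (x, v) + (disclosers D v).card := by
  unfold closedCount groupCount
  rw [← Set.ncard_coe_finset]
  refine (Set.ncard_le_ncard ?_ (Set.toFinite _)).trans (Set.ncard_union_le _ _)
  rintro j ⟨w, hj, h1, h2⟩
  rcases h2.lt_or_eq with h3 | rfl
  · exact .inl ⟨w, hj, h1, h3⟩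
  · exact .inr (by simp [disclosers, hj])

variable [BoundedOrder V]

/-- Greedy construction: cut at the least disclosed `v` for which `[x, v]` holds at least `t + 1`
disclosures. Then `[x, v)` holds at most `t`, while the next group contains `v`, so the two together
hold at least `t + 1`. The first group is kept explicit so that another one can be put in front. -/
theorem exists_partition_from {t : ℕ} (D : Fin n → Option V)
    (hD : ∀ v, (disclosers D v).card ≤ t) (N : ℕ) (x : V) (hx : x < ⊤)
    (hN : groupCount D (x, ⊤) ≤ N) :
    ∃ y gs, x < y ∧ (∀ g ∈ (x, y) :: gs, g.1 < g.2) ∧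
      ((x, y) :: gs).IsChain (fun g g' => g.2 = g'.1) ∧
      ((x, y) :: gs).getLast?.map Prod.snd = some ⊤ ∧
      (∀ g ∈ (x, y) :: gs, groupCount D g ≤ t) ∧
      ((x, y) :: gs).IsChain (fun g g' => t + 1 ≤ groupCount D g + groupCount D g') := by
  induction N using Nat.strong_induction_on generalizing x with
  | _ N ih =>
  by_cases hle : groupCount D (x, ⊤) ≤ t
  · exact ⟨⊤, [], hx, by simpa using hx, by simp, by simp, by simpa using hle, by simp⟩
  · obtain ⟨v₀, hd₀, hxv₀, hv₀, hc₀⟩ := exists_closedCount_eq D (x := x) (y := ⊤) (by omega)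
    have hfin : {v | (∃ j, D j = some v) ∧ x ≤ v ∧ v < ⊤ ∧ t + 1 ≤ closedCount D x v}.Finite := by
      refine ((Set.finite_range D).preimage (Option.some_injective V).injOn).subset ?_
      rintro v ⟨⟨j, hj⟩, _⟩
      exact ⟨j, hj⟩
    obtain ⟨v, ⟨hd, hxv, hvt, hcv⟩, hmin⟩ := Set.exists_min_image _ id hfin
      ⟨v₀, hd₀, hxv₀, hv₀, by omega⟩
    -- Otherwise the greatest disclosed value below `v` would already have been a cut point.
    have hgv : groupCount D (x, v) ≤ t := by
      by_contra hcon
      obtain ⟨w, hdw, hxw, hwv, hcw⟩ := exists_closedCount_eq D (x := x) (y := v) (by omega)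
      have := hmin w ⟨hdw, hxw, hwv.trans hvt, by omega⟩
      exact absurd hwv (not_lt.2 this)
    -- At most `t` of the `t + 1` values in `[x, v]` equal `v`. This makes the group nonempty and
    -- the recursion on the remaining count terminate.
    have hpos : 0 < groupCount D (x, v) := by
      have := closedCount_le_add_disclosers D x v
      have := hD v
      omega
    have hxv' : x < v := by
      rcases hxv.lt_or_eq with h | rfl
      · exact h
      · obtain ⟨w, _, h1, h2, _⟩ := exists_closedCount_eq D hpos
        exact absurd h2 (not_lt.2 h1)
    have hadd := groupCount_add D hxv hvt.le
    obtain ⟨y, gs, hvy, h1, h2, h3, h4, h5⟩ := ih (groupCount D (v, ⊤)) (by omega) v hvt le_rfl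
    refine ⟨v, (v, y) :: gs, hxv', ?_, ?_, ?_, ?_, ?_⟩
    · rintro g hg
      rcases List.mem_cons.1 hg with rfl | hg
      · exact hxv'
      · exact h1 g hg
    · exact List.IsChain.cons_cons rfl h2
    · rw [List.getLast?_cons_cons]; exact h3
    · rintro g hg
      rcases List.mem_cons.1 hg with rfl | hg
      · exact hgv
      · exact h4 g hg
    · exact List.IsChain.cons_cons
        (hcv.trans (closedCount_le_groupCount_add D x v y hvy)) h5

theorem exists_isPartition {t : ℕ} (D : Fin n → Option V)
    (hD : ∀ v, (disclosers D v).card ≤ t) (hV : (⊥ : V) < ⊤) :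
    ∃ gs, IsPartition t D gs := by
  obtain ⟨y, gs, _, h1, h2, h3, h4, h5⟩ := exists_partition_from D hD _ ⊥ hV le_rfl
  exact ⟨_, ⟨h1, h2, rfl, h3⟩, h4, h5⟩

theorem isPartition_partition {t : ℕ} {D : Fin n → Option V} (h : ∃ gs, IsPartition t D gs) :
    IsPartition t D (partition t D) := by
  rw [partition, dif_pos h]
  exact h.choose_spec

/-- Six groups would form three disjoint adjacent pairs, with at least `3 * (t + 1) > n` disclosures
in all. -/
theorem IsPartition.length_le {t : ℕ} (hn : n ≤ 3 * t + 1) {D : Fin n → Option V}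
    {gs : List (V × V)} (h : IsPartition t D gs) : gs.length ≤ maxGroups := by
  by_contra hlen
  obtain ⟨⟨hlt, hch, _, _⟩, _, hadj⟩ := h
  match gs, hlen, hlt, hch, hadj with
  | (a₁, b₁) :: (a₂, b₂) :: (a₃, b₃) :: (a₄, b₄) :: (a₅, b₅) :: (a₆, b₆) :: gs, _, hlt, hch, hadj =>
    simp only [List.isChain_cons_cons] at hch hadj
    obtain ⟨rfl, rfl, rfl, rfl, rfl, _⟩ := hch
    simp only [List.mem_cons, forall_eq_or_imp] at hlt
    obtain ⟨h1, h2, h3, h4, h5, h6, _⟩ := hlt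
    have e1 := groupCount_add D h1.le h2.le
    have e2 := groupCount_add D (h1.trans h2).le h3.le
    have e3 := groupCount_add D ((h1.trans h2).trans h3).le h4.le
    have e4 := groupCount_add D (((h1.trans h2).trans h3).trans h4).le h5.le
    have e5 := groupCount_add D ((((h1.trans h2).trans h3).trans h4).trans h5).le h6.le
    have := groupCount_le D (a₁, b₆)
    omega
  | [], hlen, _, _, _ | [_], hlen, _, _, _ | [_, _], hlen, _, _, _ | [_, _, _], hlen, _, _, _
  | [_, _, _, _], hlen, _, _, _ | [_, _, _, _, _], hlen, _, _, _ => simp [maxGroups] at hlen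

theorem length_partition_le {t : ℕ} (hn : n ≤ 3 * t + 1) (D : Fin n → Option V) :
    (partition t D).length ≤ maxGroups := by
  by_cases h : ∃ gs, IsPartition t D gs
  · exact (isPartition_partition h).length_le hn
  · simp [partition, dif_neg h]

end Partition

theorem Certificate.words_single {n : ℕ} {V : Type u} (s : TSig n (Content V)) :
    (Certificate.single s).words = 1 := rfl

theorem pairWords_some {n : ℕ} {V : Type u} (c : V × Certificate n V) :
    pairWords (some c) = 1 + c.2.words := rfl

/-! ### Invariants and message sizes in a single round. -/

section LocalRounds

variable {n : ℕ} {V : Type u}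

theorem length_le_of_find?_eq_some {l : List (List (V × V))} {gs : List (V × V)}
    (h : l.find? (fun gs => decide (gs.length ≤ maxGroups)) = some gs) :
    gs.length ≤ maxGroups := by
  simpa using List.find?_some h

theorem constructNegative_words_le {t : ℕ} {inbox : Fin n → List (Msg n V)}
    {o : Option (List (V × V))} {S : Certificate n V} (h : constructNegative t inbox o = some S)
    (ho : ∀ gs, o = some gs → gs.length ≤ maxGroups) : S.words ≤ 15 := by
  cases o with
  | none => simp [constructNegative] at h
  | some gs =>
    have := ho gs rfl
    simp only [constructNegative] at h
    split_ifs at h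
    cases h
    simp only [maxGroups] at this
    simp only [Certificate.words, List.length_map]
    omega

variable [LinearOrder V] [BoundedOrder V]

theorem firstValid_valid {t : ℕ} {l : List (V × Certificate n V)} {c : V × Certificate n V}
    (h : firstValid t l = some c) : Valid t c := by
  simpa using List.find?_some h

theorem firstValid_ne_none {t : ℕ} {l : List (V × Certificate n V)} {c : V × Certificate n V}
    (hc : c ∈ l) (h : Valid t c) : firstValid t l ≠ none := by
  intro hn
  simpa [h] using List.find?_eq_none.1 hn c hc

theorem Valid.words_le {t : ℕ} {c : V × Certificate n V} (h : Valid t c) : c.2.words ≤ 15 := by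
  obtain ⟨v, s | gs⟩ := c
  · simp [Certificate.words]
  · have := h.1
    simp only [maxGroups] at this
    simp only [Certificate.words]
    omega

theorem valid_combine_value {t : ℕ} {v : V} {S : Finset (Fin n)} (h : t + 1 ≤ S.card) :
    Valid t (v, .single (combine (.value v) S)) := .inl ⟨rfl, h⟩

theorem valid_combine_anyValue {t : ℕ} {v : V} {S : Finset (Fin n)} (h : t + 1 ≤ S.card) :
    Valid t (v, .single (combine .anyValue S)) := .inr ⟨rfl, h⟩

/-- Acquired certificates are valid, and the leader has formed few groups. -/
def LocalInv (t : ℕ) (s : LocalState n V) : Prop :=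
  (∀ c, s.cert = some c → Valid t c) ∧ ∀ gs, s.groups = some gs → gs.length ≤ maxGroups

theorem LocalInv.setCert {t : ℕ} {s : LocalState n V} (hs : LocalInv t s)
    {c : V × Certificate n V} (hc : Valid t c) : LocalInv t { s with cert := some c } :=
  ⟨fun _ h => Option.some.inj h ▸ hc, hs.2⟩

theorem LocalInv.pairWords_le {t : ℕ} {s : LocalState n V} (hs : LocalInv t s) :
    pairWords s.cert ≤ 16 := by
  cases h : s.cert with
  | none => simp [pairWords]
  | some c =>
    have := (hs.1 c h).words_le
    simp only [pairWords]
    omega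

/-! ### One round of BUCKET -/

variable {cfg : Config V} {L i : Fin n} {k : ℕ} {s : LocalState n V}

theorem bucketRound_proposal : (bucketRound cfg L i k s).1.proposal = s.proposal := by
  unfold bucketRound
  split <;> (try dsimp only) <;> (repeat' split) <;> rfl

theorem bucketRound_started (hk : k ≠ 1) : (bucketRound cfg L i k s).1.started = s.started := by
  unfold bucketRound
  split <;> (try dsimp only) <;> (repeat' split) <;> first | rfl | exact absurd rfl hk

theorem bucketRound_cert_ne_none (h : s.cert ≠ none) :
    (bucketRound cfg L i k s).1.cert ≠ none := by
  unfold bucketRound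
  split <;> (try dsimp only) <;> (repeat' split) <;> first | exact h | exact Option.some_ne_none _

theorem LocalInv.bucketRound (hn : n ≤ 3 * cfg.t + 1) (hs : LocalInv cfg.t s) :
    LocalInv cfg.t (bucketRound cfg L i k s).1 := by
  unfold SBA.bucketRound
  split <;> (try dsimp only) <;> (repeat' split) <;>
    first
    | exact hs
    | exact hs.setCert (firstValid_valid ‹_›)
    | exact ⟨hs.1, fun _ h => Option.some.inj h ▸ length_partition_le hn _⟩
    | exact ⟨hs.1, fun _ h => absurd h (by simp)⟩

/-- A certificate has at most five groups of three words, so a pair has at most 16 words. The bound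
18 is the one needed for HELP_REPLY, which adds its kind and a signature; it serves both phases. -/
theorem bucketRound_words_le (hn : n ≤ 3 * cfg.t + 1) (hs : LocalInv cfg.t s) (j : Fin n) :
    (((bucketRound cfg L i k s).2 j).map Msg.words).sum ≤ 18 := by
  have hw := hs.pairWords_le
  have hp := length_partition_le hn (disclosures s.inbox)
  simp only [maxGroups] at hp
  unfold bucketRound
  split <;> (try dsimp only) <;> (repeat' split) <;>
    simp only [silent, broadcast, sendTo] <;> (repeat' split) <;>
    simp only [List.map_cons, List.map_nil, List.sum_cons, List.sum_nil, Msg.words, pairWords_some,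
      Certificate.words_single, List.length_map] <;>
    first
    | omega
    | exact (Nat.add_le_add_left (Nat.mul_le_mul_left 3 ((List.length_filter_le _ _).trans
        (length_le_of_find?_eq_some ‹_›))) 1).trans (by norm_num [maxGroups])
    | have := constructNegative_words_le ‹_› hs.2
      omega

theorem bucketRound_send_eq_nil (hi : i ≠ L) {j : Fin n} (hj : j ≠ L) :
    (bucketRound cfg L i k s).2 j = [] := by
  unfold bucketRound
  split <;> (try dsimp only) <;> (repeat' split) <;> simp_all [silent, sendTo]

/-! ### One round of the agreement phase -/

theorem agreementRound_cert_ne_none (h : s.cert ≠ none) :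
    (agreementRound cfg i k s).1.cert ≠ none := by
  unfold agreementRound
  split <;> (try dsimp only) <;> (repeat' split) <;> first | exact h | exact Option.some_ne_none _

/-- The last round is excluded because there a process combines whatever ALLOW-ANY signatures it
has, possibly fewer than `t + 1`. -/
theorem LocalInv.agreementRound (hs : LocalInv cfg.t s) (hk : k ≠ 3) :
    LocalInv cfg.t (agreementRound cfg i k s).1 := by
  unfold SBA.agreementRound
  split <;> (try dsimp only) <;> (repeat' split) <;>
    first
    | exact hs
    | exact absurd rfl hk
    | exact hs.setCert (firstValid_valid ‹_›)
    | exact hs.setCert (valid_combine_value (Exists.choose_spec ‹_›))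

theorem agreementRound_words_le (hs : LocalInv cfg.t s) (j : Fin n) :
    (((agreementRound cfg i k s).2 j).map Msg.words).sum ≤ 18 := by
  have hw := hs.pairWords_le
  unfold agreementRound
  split <;> (try dsimp only) <;> (repeat' split) <;>
    (try simp only [silent, broadcast]) <;>
    simp only [List.map_cons, List.map_nil, List.sum_cons, List.sum_nil, Msg.words, pairWords_some,
      Certificate.words_single] <;>
    first
    | omega
    | have := (firstValid_valid ‹_›).words_le
      omega

end LocalRounds

/-! ### Executions before EBA. -/

/-- An execution of STRONG before EBA, restricted to the messages of BUCKET and of the agreement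
phase. -/
structure LocalRun {n : ℕ} {V : Type u} [LinearOrder V] [BoundedOrder V] (cfg : Config V)
    (B : Finset (Fin n)) where
  state : ℕ → Fin n → LocalState n V
  sent : ℕ → Fin n → Fin n → List (Msg n V)
  round_zero : ∀ i ∉ B, (state 0 i).round = 0
  cert_zero : ∀ i ∉ B, (state 0 i).cert = none
  groups_zero : ∀ i ∉ B, (state 0 i).groups = none
  inbox_zero : ∀ i ∉ B, ∀ j, (state 0 i).inbox j = []
  sent_eq : ∀ r < ebaStart cfg, ∀ i ∉ B, ∀ j, sent r i j = (localRound cfg i (state r i)).2 j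
  state_succ : ∀ r < ebaStart cfg, ∀ i ∉ B, state (r + 1) i =
    { (localRound cfg i (state r i)).1 with
      round := (state r i).round + 1
      inbox := fun j => if ((state r i).round + 1) % 6 = 0 then []
        else (state r i).inbox j ++ sent r j i }

namespace LocalRun

variable {n : ℕ} {V : Type u} [LinearOrder V] [BoundedOrder V] {cfg : Config V}
  {B : Finset (Fin n)} (R : LocalRun cfg B)

theorem round_eq {i : Fin n} (hi : i ∉ B) {r : ℕ} (hr : r ≤ ebaStart cfg) :
    (R.state r i).round = r := by
  induction r with
  | zero => exact R.round_zero i hi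
  | succ r ih => rw [R.state_succ r hr i hi]; simp [ih (by omega)]

/-- The agreement phase also starts at a multiple of 6, so the case `q = cfg.tO + 1` describes its
inboxes. -/
theorem inbox_eq {i : Fin n} (hi : i ∉ B) (q k : ℕ) (hk : k < 6) (hr : 6 * q + k ≤ ebaStart cfg)
    (j : Fin n) :
    (R.state (6 * q + k) i).inbox j = (List.range k).flatMap fun l => R.sent (6 * q + l) j i := by
  induction k with
  | zero =>
    cases q with
    | zero => simpa using R.inbox_zero i hi j
    | succ q =>
      have := R.state_succ (6 * q + 5) (by omega) i hi
      rw [show 6 * (q + 1) + 0 = 6 * q + 5 + 1 by ring, this,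
        R.round_eq hi (by omega : 6 * q + 5 ≤ _)]
      simp [show (6 * q + 5 + 1) % 6 = 0 by omega]
  | succ k ih =>
    rw [← add_assoc, R.state_succ (6 * q + k) (by omega) i hi]
    simp only [R.round_eq hi (by omega : 6 * q + k ≤ _)]
    rw [if_neg (by omega), ih (by omega) (by omega), List.range_succ, List.flatMap_append]
    simp

variable {i : Fin n} {r : ℕ}

theorem localRound_eq_bucketRound (hi : i ∉ B) {q k : ℕ} (hq : q < n) (hqt : q ≤ cfg.tO)
    (hk : k < 6) : localRound cfg i (R.state (6 * q + k) i) =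
      bucketRound cfg ⟨q, hq⟩ i k (R.state (6 * q + k) i) := by
  have hl : 6 * q + k < bucketLength cfg := by unfold bucketLength; omega
  have hr := R.round_eq hi (r := 6 * q + k) (by unfold ebaStart; omega)
  have h1 : (R.state (6 * q + k) i).round / 6 = q := by omega
  have h2 : (R.state (6 * q + k) i).round % 6 = k := by omega
  rw [localRound, if_pos (by omega), dif_pos (by omega)]
  simp only [h1, h2]

theorem localRound_eq_agreementRound (hi : i ∉ B) {k : ℕ} (hk : k < 4) :
    localRound cfg i (R.state (bucketLength cfg + k) i) =
      agreementRound cfg i k (R.state (bucketLength cfg + k) i) := by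
  have hr := R.round_eq hi (r := bucketLength cfg + k) (by unfold ebaStart; omega)
  rw [localRound, if_neg (by omega), hr, Nat.add_sub_cancel_left]

theorem cert_succ (hi : i ∉ B) (hr : r < ebaStart cfg) :
    (R.state (r + 1) i).cert = (localRound cfg i (R.state r i)).1.cert := by
  rw [R.state_succ r hr i hi]

/-- An analysis of the rounds before EBA. -/
theorem round_cases (hn : cfg.tO < n) (hr : r < ebaStart cfg) :
    (∃ q k, ∃ h : q < n, q ≤ cfg.tO ∧ k < 6 ∧ r = 6 * q + k ∧ ∀ i ∉ B,
      localRound cfg i (R.state r i) = bucketRound cfg ⟨q, h⟩ i k (R.state r i)) ∨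
    ∃ k < 4, r = bucketLength cfg + k ∧ ∀ i ∉ B,
      localRound cfg i (R.state r i) = agreementRound cfg i k (R.state r i) := by
  rcases lt_or_ge r (bucketLength cfg) with h | h
  · have hq : r / 6 ≤ cfg.tO := by unfold bucketLength at h; omega
    have hr' : r = 6 * (r / 6) + r % 6 := by omega
    refine .inl ⟨r / 6, r % 6, by omega, hq, by omega, hr', fun i hi => ?_⟩
    have := R.localRound_eq_bucketRound hi (by omega : r / 6 < n) hq (by omega : r % 6 < 6)
    rwa [← hr'] at this
  · have hk : r - bucketLength cfg < 4 := by unfold ebaStart at hr; omega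
    have hr' : r = bucketLength cfg + (r - bucketLength cfg) := by omega
    refine .inr ⟨_, hk, hr', fun i hi => ?_⟩
    have := R.localRound_eq_agreementRound hi hk
    rwa [← hr'] at this

theorem cert_ne_none_succ (hn : cfg.tO < n) (hi : i ∉ B) (hr : r < ebaStart cfg)
    (h : (R.state r i).cert ≠ none) : (R.state (r + 1) i).cert ≠ none := by
  rw [R.cert_succ hi hr]
  rcases R.round_cases hn hr with ⟨q, k, hq, -, -, -, he⟩ | ⟨k, -, -, he⟩ <;> rw [he i hi]
  · exact bucketRound_cert_ne_none h
  · exact agreementRound_cert_ne_none h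

theorem cert_ne_none_mono (hn : cfg.tO < n) (hi : i ∉ B) {r' : ℕ} (hrr : r ≤ r')
    (hr : r' ≤ ebaStart cfg) (h : (R.state r i).cert ≠ none) : (R.state r' i).cert ≠ none := by
  induction r', hrr using Nat.le_induction with
  | base => exact h
  | succ m _ ih => exact R.cert_ne_none_succ hn hi hr (ih (by omega))

/-- The range ends with the state before the last agreement round, which still covers every state
from which a message is sent before EBA. -/
theorem inv (hn : cfg.tO < n) (hn3 : n ≤ 3 * cfg.t + 1) (hi : i ∉ B)
    (hr : r ≤ bucketLength cfg + 3) : LocalInv cfg.t (R.state r i) := by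
  induction r with
  | zero => exact ⟨by simp [R.cert_zero i hi], by simp [R.groups_zero i hi]⟩
  | succ r ih =>
    have hr' : r < ebaStart cfg := by unfold ebaStart; omega
    suffices h : LocalInv cfg.t (localRound cfg i (R.state r i)).1 by
      rw [R.state_succ r hr' i hi]; exact h
    rcases R.round_cases hn hr' with ⟨q, k, hq, -, -, -, he⟩ | ⟨k, -, hk, he⟩ <;> rw [he i hi]
    · exact (ih (by omega)).bucketRound hn3
    · exact (ih (by omega)).agreementRound (by omega)

theorem words_le (hn : cfg.tO < n) (hn3 : n ≤ 3 * cfg.t + 1) (hi : i ∉ B)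
    (hr : r < ebaStart cfg) (j : Fin n) : ((R.sent r i j).map Msg.words).sum ≤ 18 := by
  have hinv := R.inv hn hn3 hi (r := r) (by unfold ebaStart at hr; omega)
  rw [R.sent_eq r hr i hi]
  rcases R.round_cases hn hr with ⟨q, k, hq, -, -, -, he⟩ | ⟨k, -, hk, he⟩ <;> rw [he i hi]
  · exact bucketRound_words_le hn3 hinv j
  · exact agreementRound_words_le hinv j

/-! ### One iteration of BUCKET -/

variable {q : ℕ}

theorem bucket_sent_eq (hq : q < n) (hqt : q ≤ cfg.tO) (hi : i ∉ B) {k : ℕ} (hk : k < 6) (j : Fin n) :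
    R.sent (6 * q + k) i j = (bucketRound cfg ⟨q, hq⟩ i k (R.state (6 * q + k) i)).2 j := by
  rw [← R.localRound_eq_bucketRound hi hq hqt hk]
  exact R.sent_eq _ (by unfold ebaStart bucketLength; omega) i hi j

theorem bucket_state_succ (hq : q < n) (hqt : q ≤ cfg.tO) (hi : i ∉ B) {k : ℕ} (hk : k < 6) :
    ∃ r inb, R.state (6 * q + (k + 1)) i =
      { (bucketRound cfg ⟨q, hq⟩ i k (R.state (6 * q + k) i)).1 with round := r, inbox := inb } := by
  rw [← R.localRound_eq_bucketRound hi hq hqt hk]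
  exact ⟨_, _, R.state_succ (6 * q + k) (by unfold ebaStart bucketLength; omega) i hi⟩

end LocalRun

/-! ### The individual rounds of an iteration of BUCKET. -/

section BucketRounds

variable {n : ℕ} {V : Type u} [LinearOrder V] [BoundedOrder V] {cfg : Config V} {L i : Fin n}
  {s : LocalState n V}

theorem bucketRound_zero_state : (bucketRound cfg L i 0 s).1 = s := by
  simp only [bucketRound]; split <;> rfl

theorem bucketRound_zero_send (j : Fin n) : (bucketRound cfg L i 0 s).2 j =
    if s.cert = none ∧ (i = L ∨ j = L) then [.aidReq] else [] := by
  unfold bucketRound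
  by_cases h : s.cert = none <;> by_cases h1 : i = L <;> simp [h, h1, broadcast, sendTo, silent]

theorem bucketRound_one_announced : (bucketRound cfg L i 1 s).1.announced = false := by
  simp only [bucketRound]; split <;> rfl

open scoped Classical in
theorem bucketRound_one_started :
    (bucketRound cfg L i 1 s).1.started = decide (Msg.aidReq ∈ s.inbox L) := by
  simp only [bucketRound]; split <;> simp [*]

theorem bucketRound_one_send_of_mem (h : Msg.aidReq ∈ s.inbox L) :
    (bucketRound cfg L i 1 s).2 =
      sendTo L (.disclose s.proposal (shareSign i (.value s.proposal))) := by
  simp [bucketRound, h]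

open scoped Classical in
theorem bucketRound_one_send_of_notMem (h : Msg.aidReq ∉ s.inbox L) (j : Fin n) :
    (bucketRound cfg L i 1 s).2 j =
      if i = L ∧ Msg.aidReq ∈ s.inbox j then [.aidReply s.cert] else [] := by
  by_cases h1 : i = L
  · subst h1; simp [bucketRound, h]
  · simp [bucketRound, h, h1, silent]

theorem bucketRound_send_of_not_started {k : ℕ} (hk : 2 ≤ k) (h : s.started = false) (j : Fin n) :
    (bucketRound cfg L i k s).2 j = [] := by
  unfold bucketRound
  split <;> first | omega | (simp only [h]; (repeat' split) <;> simp_all [silent])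

theorem bucketRound_two_cert_of_reply (h : s.started = false) {c : V × Certificate n V}
    (hc : Msg.aidReply (some c) ∈ s.inbox L) (hv : Valid cfg.t c) :
    (bucketRound cfg L i 2 s).1.cert ≠ none := by
  have := firstValid_ne_none (l := (s.inbox L).filterMap Msg.aidReply?)
    (List.mem_filterMap.2 ⟨_, hc, rfl⟩) hv
  simp only [bucketRound, h]
  rw [if_neg (by simp)]
  split
  · simp
  · contradiction

theorem bucketRound_five_cert_of_certificate (h : s.started = true) {c : V × Certificate n V}
    (hc : Msg.certificate c ∈ s.inbox L) (hv : Valid cfg.t c) :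
    (bucketRound cfg L i 5 s).1.cert ≠ none := by
  have := firstValid_ne_none (l := (s.inbox L).filterMap Msg.certificate?)
    (List.mem_filterMap.2 ⟨_, hc, rfl⟩) hv
  simp only [bucketRound, h, if_true]
  split
  · simp
  · contradiction

theorem bucketRound_two_of_exists (h : s.started = true)
    (hv : ∃ v, cfg.t + 1 ≤ (disclosers (disclosures s.inbox) v).card) :
    ∃ c, Valid cfg.t c ∧ (bucketRound cfg L L 2 s).2 = broadcast (.certificate c) := by
  refine ⟨(hv.choose, _), valid_combine_value hv.choose_spec, ?_⟩
  simp only [bucketRound, h, if_true, dif_pos hv]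

open scoped Classical in
theorem bucketRound_two_of_not_exists (h : s.started = true)
    (hv : ¬ ∃ v, cfg.t + 1 ≤ (disclosers (disclosures s.inbox) v).card)
    (hd : n - cfg.tO ≤ (Finset.univ.filter fun j => disclosures s.inbox j ≠ none).card) :
    (bucketRound cfg L L 2 s).1.groups = some (partition cfg.t (disclosures s.inbox)) ∧
    (bucketRound cfg L L 2 s).1.announced = s.announced ∧
    (bucketRound cfg L L 2 s).2 =
      broadcast (.partitionReq (partition cfg.t (disclosures s.inbox))) := by
  have hd' := hd
  simp only [bucketRound, h, if_true, dif_neg hv]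
  rw [if_pos (by convert hd)]
  exact ⟨rfl, rfl, rfl⟩

theorem bucketRound_three_state : (bucketRound cfg L i 3 s).1 = s := by
  simp only [bucketRound]; (repeat' split) <;> rfl

/-- The participant answers the first short list it finds; a correct leader sends only one, whence
the singleton hypothesis. -/
theorem bucketRound_three_send (h : s.started = true) {gs : List (V × V)}
    (hgs : (s.inbox L).filterMap Msg.partitionReq? = [gs]) (hl : gs.length ≤ maxGroups) :
    ∃ ns, (bucketRound cfg L i 3 s).2 = sendTo L (.partitionReply ns) ∧
      ∀ g ∈ gs, ¬ (g.1 ≤ s.proposal ∧ s.proposal < g.2) →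
        (g, shareSign i (.group g.1 g.2)) ∈ ns := by
  refine ⟨(gs.filter fun g => decide (¬ (g.1 ≤ s.proposal ∧ s.proposal < g.2))).map
      fun g => (g, shareSign i (.group g.1 g.2)), ?_, ?_⟩
  · simp only [bucketRound, h, if_true, hgs, List.find?, decide_eq_true hl]
  · intro g hg hn
    exact List.mem_map.2 ⟨g, List.mem_filter.2 ⟨hg, decide_eq_true hn⟩, rfl⟩

theorem bucketRound_four_of_groups (h : s.started = true) (ha : s.announced = false)
    {gs : List (V × V)} (hgs : s.groups = some gs)
    (hc : ∀ g ∈ gs, cfg.t + 1 ≤ (groupSigners s.inbox g).card)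
    (hl : gs.length ≤ maxGroups) (hch : IsGroupChain gs) :
    ∃ c, Valid cfg.t c ∧ (bucketRound cfg L L 4 s).2 = broadcast (.certificate c) := by
  refine ⟨(cfg.defaultValue, .negative (gs.map fun g =>
    (g.1, g.2, combine (.group g.1 g.2) (groupSigners s.inbox g)))), ⟨?_, ?_, ?_⟩, ?_⟩
  · simpa using hl
  · simpa [List.map_map, Function.comp_def] using hch
  · intro g hg
    obtain ⟨g', hg', rfl⟩ := List.mem_map.1 hg
    exact ⟨rfl, hc g' hg'⟩
  · have : constructNegative cfg.t s.inbox s.groups = some (.negative (gs.map fun g =>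
        (g.1, g.2, combine (.group g.1 g.2) (groupSigners s.inbox g)))) := by
      rw [hgs, constructNegative, if_pos hc]
    simp [bucketRound, h, ha, this]

end BucketRounds

/-! ### Iterations whose correct leader is already certified. -/

namespace LocalRun

variable {n : ℕ} {V : Type u} [LinearOrder V] [BoundedOrder V] {cfg : Config V}
  {B : Finset (Fin n)} (R : LocalRun cfg B) {i : Fin n} {q k : ℕ}

theorem bucket_cert_succ (hq : q < n) (hqt : q ≤ cfg.tO) (hi : i ∉ B) (hk : k < 6) :
    (R.state (6 * q + (k + 1)) i).cert =
      (bucketRound cfg ⟨q, hq⟩ i k (R.state (6 * q + k) i)).1.cert := by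
  obtain ⟨_, _, h⟩ := R.bucket_state_succ hq hqt hi hk
  rw [h]

theorem bucket_started_succ (hq : q < n) (hqt : q ≤ cfg.tO) (hi : i ∉ B) (hk : k < 6) :
    (R.state (6 * q + (k + 1)) i).started =
      (bucketRound cfg ⟨q, hq⟩ i k (R.state (6 * q + k) i)).1.started := by
  obtain ⟨_, _, h⟩ := R.bucket_state_succ hq hqt hi hk
  rw [h]

theorem bucket_groups_succ (hq : q < n) (hqt : q ≤ cfg.tO) (hi : i ∉ B) (hk : k < 6) :
    (R.state (6 * q + (k + 1)) i).groups =
      (bucketRound cfg ⟨q, hq⟩ i k (R.state (6 * q + k) i)).1.groups := by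
  obtain ⟨_, _, h⟩ := R.bucket_state_succ hq hqt hi hk
  rw [h]

theorem bucket_announced_succ (hq : q < n) (hqt : q ≤ cfg.tO) (hi : i ∉ B) (hk : k < 6) :
    (R.state (6 * q + (k + 1)) i).announced =
      (bucketRound cfg ⟨q, hq⟩ i k (R.state (6 * q + k) i)).1.announced := by
  obtain ⟨_, _, h⟩ := R.bucket_state_succ hq hqt hi hk
  rw [h]

theorem bucket_proposal_eq (hq : q < n) (hqt : q ≤ cfg.tO) (hi : i ∉ B) (hk : k ≤ 6) :
    (R.state (6 * q + k) i).proposal = (R.state (6 * q) i).proposal := by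
  induction k with
  | zero => rfl
  | succ k ih =>
    obtain ⟨_, _, h⟩ := R.bucket_state_succ hq hqt hi (by omega : k < 6)
    rw [h]
    exact bucketRound_proposal.trans (ih (by omega))

theorem bucket_inbox (hqt : q ≤ cfg.tO) (hi : i ∉ B) (hk : k < 6) (j : Fin n) :
    (R.state (6 * q + k) i).inbox j = (List.range k).flatMap fun l => R.sent (6 * q + l) j i :=
  R.inbox_eq hi q k hk (by unfold ebaStart bucketLength; omega) j

theorem mem_bucket_inbox (hqt : q ≤ cfg.tO) (hi : i ∉ B) (hk : k < 6) {l : ℕ} (hl : l < k)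
    {j : Fin n} {m : Msg n V} (hm : m ∈ R.sent (6 * q + l) j i) :
    m ∈ (R.state (6 * q + k) i).inbox j := by
  rw [R.bucket_inbox hqt hi hk]
  exact List.mem_flatMap.2 ⟨l, List.mem_range.2 hl, hm⟩

theorem bucket_inbox_one (hqt : q ≤ cfg.tO) (hi : i ∉ B) (j : Fin n) :
    (R.state (6 * q + 1) i).inbox j = R.sent (6 * q) j i := by
  simp [R.bucket_inbox hqt hi (by norm_num : 1 < 6)]

theorem bucket_cert_one (hq : q < n) (hqt : q ≤ cfg.tO) (hi : i ∉ B) :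
    (R.state (6 * q + 1) i).cert = (R.state (6 * q) i).cert := by
  rw [R.bucket_cert_succ hq hqt hi (by norm_num : 0 < 6), bucketRound_zero_state]
  rfl

open scoped Classical in
theorem bucket_started_eq (hq : q < n) (hqt : q ≤ cfg.tO) (hi : i ∉ B) (hk2 : 2 ≤ k)
    (hk : k < 6) :
    (R.state (6 * q + k) i).started = decide (Msg.aidReq ∈ R.sent (6 * q) ⟨q, hq⟩ i) := by
  induction k, hk2 using Nat.le_induction with
  | base =>
    rw [R.bucket_started_succ hq hqt hi (by norm_num : 1 < 6), bucketRound_one_started,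
      R.bucket_inbox_one hqt hi]
  | succ k h2 ih =>
    rw [R.bucket_started_succ hq hqt hi (by omega : k < 6), bucketRound_started (by omega),
      ih (by omega)]

theorem bucket_sent_zero (hq : q < n) (hqt : q ≤ cfg.tO) (hi : i ∉ B) (j : Fin n) :
    R.sent (6 * q) i j = if (R.state (6 * q) i).cert = none ∧ (i = ⟨q, hq⟩ ∨ j = ⟨q, hq⟩)
      then [.aidReq] else [] :=
  (R.bucket_sent_eq hq hqt hi (by norm_num : 0 < 6) j).trans (bucketRound_zero_send j)

/-- If the correct leader has a certificate, then nobody participates in the iteration. -/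
theorem bucket_not_started (hq : q < n) (hqt : q ≤ cfg.tO) (hL : ⟨q, hq⟩ ∉ B)
    (hc : (R.state (6 * q) ⟨q, hq⟩).cert ≠ none) (hi : i ∉ B) (hk2 : 2 ≤ k) (hk : k < 6) :
    (R.state (6 * q + k) i).started = false := by
  rw [R.bucket_started_eq hq hqt hi hk2 hk, R.bucket_sent_zero hq hqt hL]
  simp [hc]

/-- If the correct leader has a certificate, then in round 2 of the iteration it answers the
requests, and the other correct processes are silent. -/
theorem bucket_sent_one (hq : q < n) (hqt : q ≤ cfg.tO) (hL : ⟨q, hq⟩ ∉ B)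
    (hc : (R.state (6 * q) ⟨q, hq⟩).cert ≠ none) (hi : i ∉ B) (j : Fin n)
    [Decidable (i = ⟨q, hq⟩ ∧ Msg.aidReq ∈ R.sent (6 * q) j i)] :
    R.sent (6 * q + 1) i j = if i = ⟨q, hq⟩ ∧ Msg.aidReq ∈ R.sent (6 * q) j i then
      [.aidReply (R.state (6 * q) i).cert] else [] := by
  have h1 := R.bucket_inbox_one hqt hi
  rw [R.bucket_sent_eq hq hqt hi (by norm_num : 1 < 6), bucketRound_one_send_of_notMem,
    h1, R.bucket_cert_one hq hqt hi]
  · congr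
  · rw [h1, R.bucket_sent_zero hq hqt hL]
    simp [hc]

/-- If all correct processes have certificates and the leader is correct, then in the iteration only
messages from the leader to faulty processes are sent. -/
theorem bucket_sent_of_certified (hq : q < n) (hqt : q ≤ cfg.tO) (hL : ⟨q, hq⟩ ∉ B)
    (hc : ∀ i ∉ B, (R.state (6 * q) i).cert ≠ none) (hi : i ∉ B) (hk : k < 6) {j : Fin n}
    (hs : R.sent (6 * q + k) i j ≠ []) : i = ⟨q, hq⟩ ∧ j ∈ B := by
  classical
  match k, hk with
  | 0, _ => exact absurd (by rw [add_zero, R.bucket_sent_zero hq hqt hi]; simp [hc i hi]) hs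
  | 1, _ =>
    rw [R.bucket_sent_one hq hqt hL (hc _ hL) hi] at hs
    split_ifs at hs with h
    · refine ⟨h.1, by_contra fun hj => ?_⟩
      have := h.2
      rw [R.bucket_sent_zero hq hqt hj] at this
      simp [hc j hj] at this
    · exact absurd rfl hs
  | k + 2, hk =>
    refine absurd ?_ hs
    rw [R.bucket_sent_eq hq hqt hi hk]
    exact bucketRound_send_of_not_started (by omega)
      (R.bucket_not_started hq hqt hL (hc _ hL) hi (by omega) hk) j

/-- An uncertified correct process has sent its request to the leader, does not participate, and so
acquires the leader's valid pair in the third round. -/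
theorem certified_of_leader_certified (hn : cfg.tO < n) (hn3 : n ≤ 3 * cfg.t + 1) (hq : q < n)
    (hqt : q ≤ cfg.tO) (hL : ⟨q, hq⟩ ∉ B) (hc : (R.state (6 * q) ⟨q, hq⟩).cert ≠ none)
    (hi : i ∉ B) : (R.state (6 * q + 6) i).cert ≠ none := by
  classical
  by_cases hci : (R.state (6 * q) i).cert = none
  · refine R.cert_ne_none_mono hn hi (r := 6 * q + 3) (by omega)
      (by unfold ebaStart bucketLength; omega) ?_
    obtain ⟨c, hcc⟩ := Option.ne_none_iff_exists'.1 hc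
    rw [R.bucket_cert_succ hq hqt hi (by norm_num : 2 < 6)]
    refine bucketRound_two_cert_of_reply (c := c)
      (R.bucket_not_started hq hqt hL hc hi le_rfl (by norm_num)) ?_
      ((R.inv hn hn3 hL (by unfold bucketLength; omega)).1 c hcc)
    refine R.mem_bucket_inbox hqt hi (by norm_num) (l := 1) (by norm_num) ?_
    rw [R.bucket_sent_one hq hqt hL hc hL, if_pos, hcc]
    · simp
    · refine ⟨rfl, ?_⟩
      rw [R.bucket_sent_zero hq hqt hi]
      simp [hci]
  · exact R.cert_ne_none_mono hn hi (by omega) (by unfold ebaStart bucketLength; omega) hci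

end LocalRun

/-! ### Iterations with an uncertified correct leader, and certification by the end of BUCKET. -/

namespace LocalRun

variable {n : ℕ} {V : Type u} [LinearOrder V] [BoundedOrder V] {cfg : Config V}
  {B : Finset (Fin n)} (R : LocalRun cfg B) {i : Fin n} {q k : ℕ}

section Uncertified

variable (hq : q < n)

theorem aidReq_mem_sent (hqt : q ≤ cfg.tO) (hL : ⟨q, hq⟩ ∉ B)
    (hc : (R.state (6 * q) ⟨q, hq⟩).cert = none) (i : Fin n) :
    Msg.aidReq ∈ R.sent (6 * q) ⟨q, hq⟩ i := by
  rw [R.bucket_sent_zero hq hqt hL]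
  simp [hc]

/-- If the correct leader has no certificate, then all correct processes participate. -/
theorem bucket_started (hqt : q ≤ cfg.tO) (hL : ⟨q, hq⟩ ∉ B)
    (hc : (R.state (6 * q) ⟨q, hq⟩).cert = none) (hi : i ∉ B) (hk2 : 2 ≤ k) (hk : k < 6) :
    (R.state (6 * q + k) i).started = true := by
  classical
  rw [R.bucket_started_eq hq hqt hi hk2 hk]
  exact decide_eq_true (R.aidReq_mem_sent hq hqt hL hc i)

theorem bucket_sent_disclose (hqt : q ≤ cfg.tO) (hL : ⟨q, hq⟩ ∉ B)
    (hc : (R.state (6 * q) ⟨q, hq⟩).cert = none) (hi : i ∉ B) :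
    R.sent (6 * q + 1) i = sendTo ⟨q, hq⟩ (.disclose (R.state (6 * q) i).proposal
      (shareSign i (.value (R.state (6 * q) i).proposal))) := by
  ext1 j
  rw [R.bucket_sent_eq hq hqt hi (by norm_num : 1 < 6), bucketRound_one_send_of_mem,
    R.bucket_proposal_eq hq hqt hi (by norm_num)]
  rw [R.bucket_inbox_one hqt hi]
  exact R.aidReq_mem_sent hq hqt hL hc i

/-- The leader sees the proposals of the correct processes. -/
theorem disclosures_eq (hqt : q ≤ cfg.tO) (hL : ⟨q, hq⟩ ∉ B)
    (hc : (R.state (6 * q) ⟨q, hq⟩).cert = none) (hi : i ∉ B) :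
    disclosures (R.state (6 * q + 2) ⟨q, hq⟩).inbox i = some (R.state (6 * q) i).proposal := by
  have h : (R.state (6 * q + 2) ⟨q, hq⟩).inbox i =
      R.sent (6 * q) i ⟨q, hq⟩ ++ R.sent (6 * q + 1) i ⟨q, hq⟩ := by
    simp [R.bucket_inbox hqt hL (by norm_num : 2 < 6), List.range_succ]
  rw [disclosures, h, R.bucket_sent_disclose hq hqt hL hc hi, R.bucket_sent_zero hq hqt hi]
  split_ifs <;> simp [sendTo, List.findSome?_cons, Msg.disclosed?, ShareVerify]

/-- If the correct leader broadcasts a valid certificate, then all correct processes acquire one. -/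
theorem certified_of_certificate_sent (hqt : q ≤ cfg.tO) (hL : ⟨q, hq⟩ ∉ B)
    (hc : (R.state (6 * q) ⟨q, hq⟩).cert = none) (hk : k < 5) {c : V × Certificate n V}
    (hv : Valid cfg.t c) (hs : R.sent (6 * q + k) ⟨q, hq⟩ = broadcast (.certificate c))
    (hi : i ∉ B) : (R.state (6 * q + 6) i).cert ≠ none := by
  rw [R.bucket_cert_succ hq hqt hi (by norm_num : 5 < 6)]
  refine bucketRound_five_cert_of_certificate (R.bucket_started hq hqt hL hc hi (by norm_num)
    (by norm_num)) (R.mem_bucket_inbox hqt hi (by norm_num) hk ?_) hv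
  rw [hs]
  simp [broadcast]

/-- A correct process withholds its signature on `g` only if its own proposal, which the leader has
seen, lies in `g`. Hence signers, faulty processes and disclosers in `g` together cover all
processes. -/
theorem le_card_groupSigners (hqt : q ≤ cfg.tO) (hL : ⟨q, hq⟩ ∉ B)
    (hc : (R.state (6 * q) ⟨q, hq⟩).cert = none) {gs : List (V × V)}
    (hl : gs.length ≤ maxGroups)
    (hs : R.sent (6 * q + 2) ⟨q, hq⟩ = broadcast (.partitionReq gs)) {g : V × V} (hg : g ∈ gs)
    (hcount : groupCount (disclosures (R.state (6 * q + 2) ⟨q, hq⟩).inbox) g ≤ cfg.t) :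
    n ≤ (groupSigners (R.state (6 * q + 4) ⟨q, hq⟩).inbox g).card + B.card + cfg.t := by
  classical
  set D := disclosures (R.state (6 * q + 2) ⟨q, hq⟩).inbox with hD
  have hin : Set.ncard {j : Fin n | ∃ v, D j = some v ∧ g.1 ≤ v ∧ v < g.2} ≤ cfg.t := hcount
  rw [Set.ncard_eq_toFinset_card'] at hin
  set G := {j : Fin n | ∃ v, D j = some v ∧ g.1 ≤ v ∧ v < g.2}.toFinset with hG
  have hsub : (Finset.univ : Finset (Fin n)) ⊆
      groupSigners (R.state (6 * q + 4) ⟨q, hq⟩).inbox g ∪ B ∪ G := by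
    intro i _
    by_cases hi : i ∈ B
    · simp [hi]
    by_cases hiG : i ∈ G
    · simp [hiG]
    refine Finset.mem_union_left _ (Finset.mem_union_left _ ?_)
    have hp : ¬ (g.1 ≤ (R.state (6 * q + 3) i).proposal ∧
        (R.state (6 * q + 3) i).proposal < g.2) := by
      rw [R.bucket_proposal_eq hq hqt hi (by norm_num)]
      intro h
      exact hiG (Set.mem_toFinset.2 ⟨_, R.disclosures_eq hq hqt hL hc hi, h⟩)
    have hreq : ((R.state (6 * q + 3) i).inbox ⟨q, hq⟩).filterMap Msg.partitionReq? = [gs] := by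
      have h : (R.state (6 * q + 3) i).inbox ⟨q, hq⟩ = R.sent (6 * q) ⟨q, hq⟩ i ++
          (R.sent (6 * q + 1) ⟨q, hq⟩ i ++ R.sent (6 * q + 2) ⟨q, hq⟩ i) := by
        simp [R.bucket_inbox hqt hi (by norm_num : 3 < 6), List.range_succ]
      rw [h, R.bucket_sent_disclose hq hqt hL hc hL, R.bucket_sent_zero hq hqt hL, hs]
      by_cases hiL : i = ⟨q, hq⟩ <;>
        simp [hc, hiL, sendTo, broadcast, List.filterMap_cons, Msg.partitionReq?]
    obtain ⟨ns, hns, hmem⟩ := bucketRound_three_send (cfg := cfg) (i := i)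
      (R.bucket_started hq hqt hL hc hi (by norm_num) (by norm_num)) hreq hl
    refine Finset.mem_filter.2 ⟨Finset.mem_univ _, ns, _, ?_, hmem g hg hp, rfl⟩
    refine R.mem_bucket_inbox hqt hL (by norm_num) (l := 3) (by norm_num) ?_
    rw [R.bucket_sent_eq hq hqt hi (by norm_num : 3 < 6), hns]
    simp [sendTo]
  have h1 := Finset.card_le_card hsub
  have h2 := Finset.card_union_le (groupSigners (R.state (6 * q + 4) ⟨q, hq⟩).inbox g ∪ B) G
  have h3 := Finset.card_union_le (groupSigners (R.state (6 * q + 4) ⟨q, hq⟩).inbox g) B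
  rw [Finset.card_univ, Fintype.card_fin] at h1
  omega

theorem certified_of_leader_uncertified (hB : B.card ≤ cfg.tO) (hn : 2 * cfg.t + 1 + cfg.tO ≤ n)
    (hn3 : n ≤ 3 * cfg.t + 1) (hqt : q ≤ cfg.tO) (hL : ⟨q, hq⟩ ∉ B)
    (hc : (R.state (6 * q) ⟨q, hq⟩).cert = none) (hi : i ∉ B) :
    (R.state (6 * q + 6) i).cert ≠ none := by
  classical
  have hst := R.bucket_started hq hqt hL hc hL (k := 2) (by norm_num) (by norm_num)
  have hD := fun j (hj : j ∉ B) => R.disclosures_eq hq hqt hL hc hj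
  have hcard : n - cfg.tO ≤ Bᶜ.card := by
    rw [Finset.card_compl, Fintype.card_fin]
    omega
  set D := disclosures (R.state (6 * q + 2) ⟨q, hq⟩).inbox with hDdef
  by_cases hv : ∃ v, cfg.t + 1 ≤ (disclosers D v).card
  · obtain ⟨c, hcv, hs⟩ := bucketRound_two_of_exists (cfg := cfg) (L := ⟨q, hq⟩) hst hv
    refine R.certified_of_certificate_sent hq hqt hL hc (k := 2) (by norm_num) hcv ?_ hi
    ext1 j
    rw [R.bucket_sent_eq hq hqt hL (by norm_num), hs]
  have hd : n - cfg.tO ≤ (Finset.univ.filter fun j => D j ≠ none).card := by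
    refine hcard.trans (Finset.card_le_card fun j hj => ?_)
    rw [Finset.mem_compl] at hj
    simp [hD j hj]
  -- With a single value there is no chain of groups, but then all correct processes disclose this
  -- value, and they number at least `n - cfg.tO ≥ t + 1`.
  have hV : (⊥ : V) < ⊤ := by
    refine bot_lt_iff_ne_bot.2 fun h => hv ⟨⊥, ?_⟩
    have := subsingleton_of_bot_eq_top h.symm
    refine le_trans (by omega) (hcard.trans (Finset.card_le_card fun j hj => ?_))
    rw [Finset.mem_compl] at hj
    simp [disclosers, hD j hj, eq_iff_true_of_subsingleton]
  have hpart := isPartition_partition (exists_isPartition (t := cfg.t) D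
    (fun v => by_contra fun h => hv ⟨v, by omega⟩) hV)
  obtain ⟨hg, ha, hs⟩ := bucketRound_two_of_not_exists hst hv hd
  have hs2 : R.sent (6 * q + 2) ⟨q, hq⟩ = broadcast (.partitionReq (partition cfg.t D)) := by
    ext1 j
    rw [R.bucket_sent_eq hq hqt hL (by norm_num), hs]
  have ha2 : (R.state (6 * q + 2) ⟨q, hq⟩).announced = false := by
    rw [R.bucket_announced_succ hq hqt hL (by norm_num : 1 < 6), bucketRound_one_announced]
  have ha4 : (R.state (6 * q + 4) ⟨q, hq⟩).announced = false := by
    rw [R.bucket_announced_succ hq hqt hL (by norm_num : 3 < 6), bucketRound_three_state,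
      R.bucket_announced_succ hq hqt hL (by norm_num : 2 < 6), ha, ha2]
  have hg4 : (R.state (6 * q + 4) ⟨q, hq⟩).groups = some (partition cfg.t D) := by
    rw [R.bucket_groups_succ hq hqt hL (by norm_num : 3 < 6), bucketRound_three_state,
      R.bucket_groups_succ hq hqt hL (by norm_num : 2 < 6), hg]
  have hlen := hpart.length_le hn3
  obtain ⟨c, hcv, hs4⟩ := bucketRound_four_of_groups (cfg := cfg) (L := ⟨q, hq⟩)
    (R.bucket_started hq hqt hL hc hL (k := 4) (by norm_num) (by norm_num)) ha4 hg4
    -- At least `n - B.card - t ≥ t + 1` signatures, since `B.card ≤ cfg.tO`.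
    (fun g hgm => by
      have := R.le_card_groupSigners hq hqt hL hc hlen hs2 hgm (hpart.2.1 g hgm)
      omega) hlen hpart.1
  refine R.certified_of_certificate_sent hq hqt hL hc (k := 4) (by norm_num) hcv ?_ hi
  ext1 j
  rw [R.bucket_sent_eq hq hqt hL (by norm_num), hs4]

end Uncertified

/-- After an iteration with a correct leader all correct processes have certificates, provided
that there are at most `tO` faults. -/
theorem certified_of_leader_correct (hB : B.card ≤ cfg.tO) (hn : 2 * cfg.t + 1 + cfg.tO ≤ n)
    (hn3 : n ≤ 3 * cfg.t + 1) (hq : q < n) (hqt : q ≤ cfg.tO) (hL : ⟨q, hq⟩ ∉ B) (hi : i ∉ B) :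
    (R.state (6 * q + 6) i).cert ≠ none := by
  by_cases hc : (R.state (6 * q) ⟨q, hq⟩).cert = none
  · exact R.certified_of_leader_uncertified hq hB hn hn3 hqt hL hc hi
  · exact R.certified_of_leader_certified (by omega) hn3 hq hqt hL hc hi

/-- With at most `tO` faults, all correct processes have certificates after BUCKET. -/
theorem certified_bucketLength (hB : B.card ≤ cfg.tO) (hn : 2 * cfg.t + 1 + cfg.tO ≤ n)
    (hn3 : n ≤ 3 * cfg.t + 1) (hi : i ∉ B) : (R.state (bucketLength cfg) i).cert ≠ none := by
  -- There are `cfg.tO + 1` leaders, more than there are faulty processes.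
  obtain ⟨x, hxs, hxB⟩ := Finset.exists_mem_notMem_of_card_lt_card
    (s := B) (t := Finset.univ.map (Fin.castLEEmb (by omega : cfg.tO + 1 ≤ n)))
    (by simpa using Nat.lt_succ_of_le hB)
  obtain ⟨⟨q, hqt⟩, -, rfl⟩ := Finset.mem_map.1 hxs
  exact R.cert_ne_none_mono (by omega) hi (r := 6 * q + 6) (by unfold bucketLength; omega)
    (by unfold ebaStart; omega) (R.certified_of_leader_correct hB hn hn3 _ (by omega) hxB hi)

end LocalRun

/-! ### The agreement phase and the validity of the EBA inputs. -/

theorem mem_allMsgs {n : ℕ} {V : Type u} {inbox : Fin n → List (Msg n V)} {j : Fin n}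
    {m : Msg n V} (h : m ∈ inbox j) : m ∈ allMsgs inbox :=
  List.mem_flatMap.2 ⟨j, List.mem_finRange j, h⟩

section AgreementRounds

variable {n : ℕ} {V : Type u} [LinearOrder V] [BoundedOrder V] {cfg : Config V} {i : Fin n}
  {s : LocalState n V}

theorem agreementRound_send_of_cert {k : ℕ} (hk : k ≠ 1) (h : s.cert ≠ none) (j : Fin n) :
    (agreementRound cfg i k s).2 j = [] := by
  unfold agreementRound
  split <;> first | exact absurd rfl hk | simp [h, silent]

theorem agreementRound_cert_of_cert {k : ℕ} (h : s.cert ≠ none) :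
    (agreementRound cfg i k s).1.cert = s.cert := by
  unfold agreementRound
  split <;> simp [h]

theorem agreementRound_two_cert (h : s.cert = none) {j : Fin n} {c : V × Certificate n V}
    {sig : PSig n (Content V)} (hc : Msg.helpReply (some c) sig ∈ s.inbox j) (hv : Valid cfg.t c) :
    (agreementRound cfg i 2 s).1.cert ≠ none := by
  have := firstValid_ne_none (l := (allMsgs s.inbox).filterMap Msg.helpReply?)
    (List.mem_filterMap.2 ⟨_, mem_allMsgs hc, rfl⟩) hv
  simp only [agreementRound, h, if_true]
  split
  · simp
  · contradiction

/-- Relaying excludes the one silent case, that of a process that has just taken its pair from a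
HELP_REPLY. -/
theorem agreementRound_two_send (h : s.cert = none) (hr : cfg.relay = true) :
    (∃ c, Valid cfg.t c ∧ (agreementRound cfg i 2 s).2 = broadcast (.finalCertificate c)) ∨
      (agreementRound cfg i 2 s).2 = broadcast (.allowAny (shareSign i .anyValue)) := by
  simp only [agreementRound, h, if_true, hr]
  split
  · exact .inl ⟨_, firstValid_valid ‹_›, rfl⟩
  · split_ifs with hv
    · exact .inl ⟨_, valid_combine_value hv.choose_spec, rfl⟩
    · exact .inr rfl

theorem agreementRound_three_cert : (agreementRound cfg i 3 s).1.cert ≠ none := by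
  simp only [agreementRound]
  split_ifs with h
  · split <;> simp
  · exact h

theorem agreementRound_three_valid (h : s.cert = none)
    (hs : (∀ j c, Valid cfg.t c → Msg.finalCertificate c ∉ s.inbox j) →
      cfg.t + 1 ≤ (allowAnySigners s.inbox).card) {c : V × Certificate n V}
    (hc : (agreementRound cfg i 3 s).1.cert = some c) : Valid cfg.t c := by
  simp only [agreementRound, h, if_true] at hc
  split at hc
  · rename_i _ c' hf
    cases hc
    exact firstValid_valid hf
  · rename_i hf
    cases hc
    refine valid_combine_anyValue (hs fun j c hv hm => ?_)
    exact firstValid_ne_none (l := (allMsgs s.inbox).filterMap Msg.finalCertificate?)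
      (List.mem_filterMap.2 ⟨_, mem_allMsgs hm, rfl⟩) hv hf

end AgreementRounds

namespace LocalRun

variable {n : ℕ} {V : Type u} [LinearOrder V] [BoundedOrder V] {cfg : Config V}
  {B : Finset (Fin n)} (R : LocalRun cfg B) {i : Fin n} {k : ℕ}

theorem agreement_sent_eq (hi : i ∉ B) (hk : k < 4) (j : Fin n) :
    R.sent (bucketLength cfg + k) i j =
      (agreementRound cfg i k (R.state (bucketLength cfg + k) i)).2 j := by
  rw [← R.localRound_eq_agreementRound hi hk]
  exact R.sent_eq _ (by unfold ebaStart; omega) i hi j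

theorem agreement_cert_succ (hi : i ∉ B) (hk : k < 4) :
    (R.state (bucketLength cfg + (k + 1)) i).cert =
      (agreementRound cfg i k (R.state (bucketLength cfg + k) i)).1.cert := by
  rw [← R.localRound_eq_agreementRound hi hk]
  exact R.cert_succ (r := bucketLength cfg + k) hi (by unfold ebaStart; omega)

theorem agreement_inbox (hi : i ∉ B) (hk : k < 4) (j : Fin n) :
    (R.state (bucketLength cfg + k) i).inbox j =
      (List.range k).flatMap fun l => R.sent (bucketLength cfg + l) j i :=
  R.inbox_eq hi (cfg.tO + 1) k (by omega) (by unfold ebaStart bucketLength; omega) j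

theorem mem_agreement_inbox (hi : i ∉ B) (hk : k < 4) {l : ℕ} (hl : l < k)
    {j : Fin n} {m : Msg n V} (hm : m ∈ R.sent (bucketLength cfg + l) j i) :
    m ∈ (R.state (bucketLength cfg + k) i).inbox j := by
  rw [R.agreement_inbox hi hk]
  exact List.mem_flatMap.2 ⟨l, List.mem_range.2 hl, hm⟩

theorem agreement_cert_ne_none (hn : cfg.tO < n) (hi : i ∉ B) (hk : k ≤ 4) {l : ℕ} (hl : l ≤ k)
    (hc : (R.state (bucketLength cfg + l) i).cert ≠ none) :
    (R.state (bucketLength cfg + k) i).cert ≠ none :=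
  R.cert_ne_none_mono hn hi (by omega) (by unfold ebaStart; omega) hc

/-- If all correct processes have certificates, then in the agreement phase they only send messages
to faulty processes. -/
theorem agreement_sent_of_certified (hn : cfg.tO < n)
    (hc : ∀ i ∉ B, (R.state (bucketLength cfg) i).cert ≠ none) (hi : i ∉ B) (hk : k < 4)
    {j : Fin n} (hs : R.sent (bucketLength cfg + k) i j ≠ []) : j ∈ B := by
  by_contra hj
  have hck := R.agreement_cert_ne_none hn hi hk.le (Nat.zero_le k) (hc i hi)
  rw [R.agreement_sent_eq hi hk] at hs
  by_cases hk1 : k = 1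
  · subst hk1
    simp only [agreementRound] at hs
    split_ifs at hs with h
    · rw [R.agreement_inbox hi hk] at h
      simp only [List.range_one, List.flatMap_singleton] at h
      rw [R.agreement_sent_eq hj (by norm_num),
        agreementRound_send_of_cert (k := 0) (s := R.state (bucketLength cfg + 0) j)
          (by norm_num) (hc j hj)] at h
      exact List.not_mem_nil h
    · exact hs rfl
  · exact hs (agreementRound_send_of_cert hk1 hck j)

theorem cert_ebaStart_ne_none (hi : i ∉ B) : (R.state (ebaStart cfg) i).cert ≠ none := by
  rw [ebaStart, R.agreement_cert_succ hi (by norm_num : 3 < 4)]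
  exact agreementRound_three_cert

/-- If a correct process obtains no certificate in the first three rounds of the agreement phase,
then in round 3 each correct process broadcasts a valid certificate or ALLOW-ANY, provided that
certificates are relayed. -/
theorem agreement_sent_two (hn : cfg.tO < n) (hn3 : n ≤ 3 * cfg.t + 1) (hr : cfg.relay = true)
    (hi : i ∉ B) (hc : (R.state (bucketLength cfg + 3) i).cert = none) {j : Fin n} (hj : j ∉ B) :
    (∃ c, Valid cfg.t c ∧ Msg.finalCertificate c ∈ R.sent (bucketLength cfg + 2) j i) ∨
      Msg.allowAny (shareSign j .anyValue) ∈ R.sent (bucketLength cfg + 2) j i := by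
  have hci : ∀ l ≤ 3, (R.state (bucketLength cfg + l) i).cert = none := fun l hl =>
    by_contra fun h => R.agreement_cert_ne_none hn hi (by norm_num) hl h hc
  -- Otherwise `j` would have answered the HELP_REQ of `i` with a valid pair, and `i` would have
  -- acquired one.
  have hcj : (R.state (bucketLength cfg + 1) j).cert = none := by
    by_contra h
    obtain ⟨c, hcc⟩ := Option.ne_none_iff_exists'.1 h
    refine absurd hc ?_
    rw [R.agreement_cert_succ hi (by norm_num : 2 < 4)]
    refine agreementRound_two_cert (hci 2 (by norm_num)) (j := j) (c := c)
      (sig := shareSign j (.value (R.state (bucketLength cfg + 1) j).proposal))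
      (R.mem_agreement_inbox hi (by norm_num) (l := 1) (by norm_num) ?_)
      ((R.inv hn hn3 hj (by omega)).1 c hcc)
    have hreq : Msg.helpReq ∈ (R.state (bucketLength cfg + 1) j).inbox i := by
      refine R.mem_agreement_inbox hj (by norm_num) (l := 0) (by norm_num) ?_
      rw [R.agreement_sent_eq hi (by norm_num)]
      have : (R.state (bucketLength cfg) i).cert = none := hci 0 (by norm_num)
      simp [agreementRound, this, broadcast]
    rw [R.agreement_sent_eq hj (by norm_num)]
    simp [agreementRound, hreq, hcc]
  have hcj2 : (R.state (bucketLength cfg + 2) j).cert = none := by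
    rw [R.agreement_cert_succ hj (by norm_num : 1 < 4)]
    exact hcj
  rw [R.agreement_sent_eq hj (by norm_num)]
  rcases agreementRound_two_send (i := j) hcj2 hr with ⟨c, hv, h⟩ | h <;> rw [h]
  · exact .inl ⟨c, hv, by simp [broadcast]⟩
  · exact .inr (by simp [broadcast])

/-- All correct processes propose valid pairs to EBA. -/
theorem valid_ebaStart (hn : 2 * cfg.t + 1 + cfg.tO ≤ n) (hn3 : n ≤ 3 * cfg.t + 1)
    (hB : B.card ≤ cfg.t) (h : B.card ≤ cfg.tO ∨ cfg.relay = true) (hi : i ∉ B)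
    {c : V × Certificate n V} (hc : (R.state (ebaStart cfg) i).cert = some c) :
    Valid cfg.t c := by
  rw [ebaStart, R.agreement_cert_succ hi (by norm_num : 3 < 4)] at hc
  by_cases hci : (R.state (bucketLength cfg + 3) i).cert = none
  · rcases h with h | hr
    · exact absurd hci (R.agreement_cert_ne_none (by omega) hi (by norm_num) (Nat.zero_le 3)
        (R.certified_bucketLength h hn hn3 hi))
    · refine agreementRound_three_valid hci (fun hno => ?_) hc
      -- If no valid FINAL_CERTIFICATE arrived, every correct process must have sent ALLOW-ANY,
      -- which gives at least `n - t ≥ t + 1` signatures.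
      have hsub : Bᶜ ⊆ allowAnySigners (R.state (bucketLength cfg + 3) i).inbox := by
        classical
        intro j hj
        rw [Finset.mem_compl] at hj
        rcases R.agreement_sent_two (by omega) hn3 hr hi hci hj with ⟨c, hv, hm⟩ | hm
        · exact absurd (R.mem_agreement_inbox hi (by norm_num) (by norm_num) hm) (hno j c hv)
        · exact Finset.mem_filter.2 ⟨Finset.mem_univ _, _,
            R.mem_agreement_inbox hi (by norm_num) (by norm_num) hm, rfl⟩
      have := Finset.card_le_card hsub
      rw [Finset.card_compl, Fintype.card_fin] at this
      omega
  · rw [agreementRound_cert_of_cert hci] at hc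
    exact (R.inv (by omega) hn3 hi le_rfl).1 c hc

end LocalRun

/-! ### Counting the words sent before EBA. -/

namespace LocalRun

variable {n : ℕ} {V : Type u} [LinearOrder V] [BoundedOrder V] {cfg : Config V}
  {B : Finset (Fin n)} (R : LocalRun cfg B)

/-- The number of words sent by correct processes in round `r`. -/
def roundWords (r : ℕ) : ℕ := ∑ i ∈ Bᶜ, ∑ j, ((R.sent r i j).map Msg.words).sum

/-- A link carries at most 18 words per round, so it suffices to enclose the links in use in a set
`S`. -/
theorem roundWords_le (hn : cfg.tO < n) (hn3 : n ≤ 3 * cfg.t + 1) {r : ℕ} (hr : r < ebaStart cfg)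
    (S : Finset (Fin n × Fin n)) (hS : ∀ i ∉ B, ∀ j, R.sent r i j ≠ [] → (i, j) ∈ S) :
    R.roundWords r ≤ 18 * S.card := by
  classical
  rw [roundWords, ← Finset.sum_product']
  calc ∑ p ∈ Bᶜ ×ˢ Finset.univ, ((R.sent r p.1 p.2).map Msg.words).sum
      ≤ ∑ p ∈ Bᶜ ×ˢ Finset.univ, if p ∈ S then 18 else 0 := by
        refine Finset.sum_le_sum fun p hp => ?_
        have hi : p.1 ∉ B := Finset.mem_compl.1 (Finset.mem_product.1 hp).1
        split_ifs with h
        · exact R.words_le hn hn3 hi hr p.2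
        · have : R.sent r p.1 p.2 = [] := by_contra fun h' => h (hS _ hi _ h')
          simp [this]
    _ ≤ 18 * S.card := by
        rw [← Finset.sum_filter, Finset.sum_const, smul_eq_mul, mul_comm]
        exact Nat.mul_le_mul_left _ (Finset.card_le_card fun p hp => (Finset.mem_filter.1 hp).2)

/-- The iterations of BUCKET in which correct processes may send more than `O(f)` words. -/
def Busy (q : ℕ) : Prop :=
  (∃ x ∈ B, x.1 = q) ∨ ∃ i ∉ B, (R.state (6 * q) i).cert = none

theorem roundWords_bucket_le (hn : cfg.tO < n) (hn3 : n ≤ 3 * cfg.t + 1) {q k : ℕ}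
    (hqt : q ≤ cfg.tO) (hk : k < 6) : R.roundWords (6 * q + k) ≤ 36 * n := by
  have hq : q < n := by omega
  refine (R.roundWords_le hn hn3 (by unfold ebaStart bucketLength; omega)
    (({⟨q, hq⟩} ×ˢ Finset.univ) ∪ (Finset.univ ×ˢ {⟨q, hq⟩})) fun i hi j hs => ?_).trans ?_
  · by_contra hp
    simp only [Finset.mem_union, Finset.mem_product, Finset.mem_singleton, Finset.mem_univ,
      and_true, true_and, not_or] at hp
    rw [R.bucket_sent_eq hq hqt hi hk] at hs
    exact hs (bucketRound_send_eq_nil hp.1 hp.2)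
  · refine (Nat.mul_le_mul_left 18 (Finset.card_union_le _ _)).trans ?_
    simp only [Finset.card_product, Finset.card_singleton, Finset.card_univ, Fintype.card_fin]
    omega

theorem roundWords_bucket_le_of_not_busy (hn : cfg.tO < n) (hn3 : n ≤ 3 * cfg.t + 1) {q k : ℕ}
    (hqt : q ≤ cfg.tO) (hk : k < 6) (hb : ¬ R.Busy q) :
    R.roundWords (6 * q + k) ≤ 18 * B.card := by
  have hq : q < n := by omega
  simp only [Busy, not_or, not_exists, not_and] at hb
  refine (R.roundWords_le hn hn3 (by unfold ebaStart bucketLength; omega)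
    ({⟨q, hq⟩} ×ˢ B) fun i hi j hs => ?_).trans (by simp)
  have := R.bucket_sent_of_certified hq hqt (fun h => hb.1 _ h rfl) hb.2 hi hk hs
  exact Finset.mem_product.2 ⟨Finset.mem_singleton.2 this.1, this.2⟩

open scoped Classical in
-- Six rounds of `36 * n` words in a busy iteration, six rounds of `18 * B.card` words in any other.
theorem sum_bucket_le (hn : cfg.tO < n) (hn3 : n ≤ 3 * cfg.t + 1) {m : ℕ} (hm : m ≤ cfg.tO + 1) :
    ∑ r ∈ Finset.range (6 * m), R.roundWords r ≤
      216 * n * ((Finset.range m).filter R.Busy).card + 108 * B.card * m := by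
  induction m with
  | zero => simp
  | succ m ih =>
    rw [show 6 * (m + 1) = 6 * m + 6 by ring, Finset.sum_range_add,
      Finset.range_add_one (n := m),
      Finset.filter_insert]
    specialize ih (by omega)
    by_cases hb : R.Busy m
    · rw [if_pos hb, Finset.card_insert_of_notMem (by simp)]
      have := Finset.sum_le_card_nsmul (Finset.range 6) (fun k => R.roundWords (6 * m + k)) (36 * n)
        fun k hk => R.roundWords_bucket_le hn hn3 (by omega) (Finset.mem_range.1 hk)
      simp only [Finset.card_range, smul_eq_mul] at this
      linarith [Nat.zero_le B.card]
    · rw [if_neg hb]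
      have := Finset.sum_le_card_nsmul (Finset.range 6) (fun k => R.roundWords (6 * m + k))
        (18 * B.card)
        fun k hk => R.roundWords_bucket_le_of_not_busy hn hn3 (by omega) (Finset.mem_range.1 hk) hb
      simp only [Finset.card_range, smul_eq_mul] at this
      linarith

open scoped Classical in
-- If `B.card > cfg.tO`, there are too few iterations in all. Otherwise faulty leaders account for
-- at most `B.card` busy iterations, and of those with correct leaders only the first can be busy,
-- because everyone is certified after it.
theorem card_busy_le (hn : 2 * cfg.t + 1 + cfg.tO ≤ n) (hn3 : n ≤ 3 * cfg.t + 1) :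
    ((Finset.range (cfg.tO + 1)).filter R.Busy).card ≤ B.card + 1 := by
  rcases lt_or_ge cfg.tO B.card with hB | hB
  · refine (Finset.card_filter_le _ _).trans ?_
    rw [Finset.card_range]
    omega
  · have hsub : (Finset.range (cfg.tO + 1)).filter R.Busy ⊆ B.image Fin.val ∪
        (Finset.range (cfg.tO + 1)).filter fun q => R.Busy q ∧ q ∉ B.image Fin.val := by
      intro q hq
      by_cases h : q ∈ B.image Fin.val
      · exact Finset.mem_union_left _ h
      · rw [Finset.mem_filter] at hq
        exact Finset.mem_union_right _ (Finset.mem_filter.2 ⟨hq.1, hq.2, h⟩)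
    refine (Finset.card_le_card hsub).trans ((Finset.card_union_le _ _).trans
      (Nat.add_le_add Finset.card_image_le ?_))
    have key : ∀ q q', q < q' → q' ≤ cfg.tO → q ∉ B.image Fin.val → q' ∉ B.image Fin.val →
        ¬ R.Busy q' := by
      rintro q q' hlt hq' hqB hqB' (⟨x, hx, rfl⟩ | ⟨i, hi, hc⟩)
      · exact hqB' (Finset.mem_image_of_mem _ hx)
      · refine R.cert_ne_none_mono (by omega) hi (r := 6 * q + 6) (by omega)
          (by unfold ebaStart bucketLength; omega)
          (R.certified_of_leader_correct hB hn hn3 (by omega) (by omega) (fun h => hqB ?_) hi) hc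
        exact Finset.mem_image.2 ⟨_, h, rfl⟩
    refine Finset.card_le_one.2 fun q hq q' hq' => ?_
    simp only [Finset.mem_filter, Finset.mem_range] at hq hq'
    rcases lt_trichotomy q q' with h | h | h
    · exact absurd hq'.2.1 (key q q' h (by omega) hq.2.2 hq'.2.2)
    · exact h
    · exact absurd hq.2.1 (key q' q h (by omega) hq'.2.2 hq.2.2)

/-- With more than `cfg.tO` faults all `n ^ 2` links are charged and one factor `n` is absorbed by
`hD`; otherwise only the links to faulty processes are charged. -/
theorem sum_agreement_le (hn : 2 * cfg.t + 1 + cfg.tO ≤ n) (hn3 : n ≤ 3 * cfg.t + 1) {D : ℕ}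
    (hD : cfg.tO < B.card → n ≤ D * (B.card + 1)) :
    ∑ k ∈ Finset.range 4, R.roundWords (bucketLength cfg + k) ≤
      72 * (D + 1) * n * (B.card + 1) := by
  have h : ∀ k ∈ Finset.range 4, R.roundWords (bucketLength cfg + k) ≤
      18 * (n * ((D + 1) * (B.card + 1))) := by
    intro k hk
    rw [Finset.mem_range] at hk
    have hr : bucketLength cfg + k < ebaStart cfg := by unfold ebaStart; omega
    rcases lt_or_ge cfg.tO B.card with hB | hB
    · refine (R.roundWords_le (by omega) hn3 hr Finset.univ fun _ _ _ _ => Finset.mem_univ _).trans ?_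
      simp only [Finset.card_univ, Fintype.card_prod, Fintype.card_fin]
      gcongr
      exact (hD hB).trans (Nat.mul_le_mul_right _ (by omega))
    · refine (R.roundWords_le (by omega) hn3 hr (Finset.univ ×ˢ B) fun i hi j hs => ?_).trans ?_
      · exact Finset.mem_product.2 ⟨Finset.mem_univ _, R.agreement_sent_of_certified (by omega)
          (fun i hi => R.certified_bucketLength hB hn hn3 hi) hi hk hs⟩
      · simp only [Finset.card_product, Finset.card_univ, Fintype.card_fin]
        gcongr
        nlinarith [Nat.zero_le (D * (B.card + 1))]
  refine (Finset.sum_le_card_nsmul _ _ _ h).trans (le_of_eq ?_)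
  simp only [Finset.card_range, smul_eq_mul]
  ring

/-- Correct processes send `O(n (f + 1))` words before EBA. -/
theorem sum_ebaStart_le (hn : 2 * cfg.t + 1 + cfg.tO ≤ n) (hn3 : n ≤ 3 * cfg.t + 1) {D : ℕ}
    (hD : cfg.tO < B.card → n ≤ D * (B.card + 1)) :
    ∑ r ∈ Finset.range (ebaStart cfg), R.roundWords r ≤
      (324 + 72 * (D + 1)) * n * (B.card + 1) := by
  classical
  have h1 := R.sum_bucket_le (by omega) hn3 (m := cfg.tO + 1) le_rfl
  have h2 := R.card_busy_le hn hn3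
  have h3 := R.sum_agreement_le hn hn3 hD
  have h4 := Nat.mul_le_mul_left (216 * n) h2
  have h5 : 108 * B.card * (cfg.tO + 1) ≤ 108 * (B.card + 1) * n :=
    Nat.mul_le_mul (by omega) (by omega)
  rw [ebaStart, Finset.sum_range_add]
  rw [bucketLength] at h3 ⊢
  linarith

end LocalRun

/-! ### Splitting an execution of STRONG into its local part and an execution of EBA. -/

section Strong

variable {n : ℕ} {V : Type u} [LinearOrder V] [BoundedOrder V] {cfg : Config V}
  {E : EBAProtocol n V} {B : Finset (Fin n)} (α : Execution (strong cfg E) B) {i : Fin n} {r : ℕ}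

theorem strong_round_eq (hi : i ∉ B) (r : ℕ) : (α.state r i).1.round = r := by
  induction r with
  | zero => rw [α.state_zero i hi]; rfl
  | succ r ih =>
    rw [α.state_succ r i hi]
    exact congrArg (· + 1) ih

theorem strong_sent_eq_inl (hi : i ∉ B) (hr : r < ebaStart cfg) (j : Fin n) :
    α.sent r i j = ((localRound cfg i (α.state r i).1).2 j).map Sum.inl := by
  rw [α.sent_correct r i hi j]
  exact if_pos (by rwa [strong_round_eq α hi])

theorem strong_sent_eq_inr (hi : i ∉ B) (hr : ebaStart cfg ≤ r) (j : Fin n) :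
    α.sent r i j = ((α.state r i).2.elim [] fun e => E.send i e j).map Sum.inr := by
  rw [α.sent_correct r i hi j]
  exact if_neg (by rw [strong_round_eq α hi]; omega)

/-- The rounds of an execution of STRONG before EBA. -/
def strongLocalRun : LocalRun cfg B where
  state r i := (α.state r i).1
  sent r i j := List.filterMap (α := Msg n V ⊕ E.Msg) Sum.getLeft? (α.sent r i j)
  round_zero i hi := strong_round_eq α hi 0
  cert_zero i hi := by rw [α.state_zero i hi]; rfl
  groups_zero i hi := by rw [α.state_zero i hi]; rfl
  inbox_zero i hi j := by rw [α.state_zero i hi]; rfl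
  sent_eq r hr i hi j := by
    rw [strong_sent_eq_inl α hi hr, List.filterMap_map]
    exact List.filterMap_some
  state_succ r _ i hi := by
    rw [α.state_succ r i hi]
    rfl

theorem strong_eba_state (hi : i ∉ B) :
    (α.state (ebaStart cfg) i).2 = (α.state (ebaStart cfg) i).1.cert.map (E.start i) := by
  have hs := α.state_succ (bucketLength cfg + 3) i hi
  have hr := strong_round_eq α hi (bucketLength cfg + 3)
  rw [show ebaStart cfg = bucketLength cfg + 3 + 1 from rfl, hs]
  exact (if_neg (by rw [hr]; simp [ebaStart])).trans (if_pos (by rw [hr]; rfl))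

theorem strong_eba_state_succ (hi : i ∉ B) (hr : ebaStart cfg ≤ r) :
    (α.state (r + 1) i).2 = (α.state r i).2.map fun e => E.recv i e fun j =>
      List.filterMap (α := Msg n V ⊕ E.Msg) Sum.getRight? (α.sent r j i) := by
  have hro := strong_round_eq α hi r
  rw [α.state_succ r i hi]
  exact (if_neg (by rw [hro]; omega)).trans (if_neg (by rw [hro]; omega))

theorem strong_eba_state_ne_none (hi : i ∉ B) (r : ℕ) :
    (α.state (ebaStart cfg + r) i).2 ≠ none := by
  induction r with
  | zero =>
    rw [add_zero, strong_eba_state α hi]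
    exact Option.map_eq_none_iff.not.2 ((strongLocalRun α).cert_ebaStart_ne_none hi)
  | succ r ih =>
    rw [← add_assoc, strong_eba_state_succ α hi (by omega)]
    exact Option.map_eq_none_iff.not.2 ih

/-- The execution of EBA within an execution of STRONG. -/
noncomputable def strongEBA : Execution E B where
  -- The default pair never matters for a correct process, which always has a pair when EBA starts.
  input i := (α.state (ebaStart cfg) i).1.cert.getD (⊥, .negative [])
  state r i := (α.state (ebaStart cfg + r) i).2.getD
    (E.start i ((α.state (ebaStart cfg) i).1.cert.getD (⊥, .negative [])))
  sent r i j := List.filterMap (α := Msg n V ⊕ E.Msg) Sum.getRight? (α.sent (ebaStart cfg + r) i j)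
  state_zero i hi := by
    rw [add_zero, strong_eba_state α hi]
    obtain ⟨c, hc⟩ := Option.ne_none_iff_exists'.1
      ((strongLocalRun α).cert_ebaStart_ne_none hi)
    replace hc : (α.state (ebaStart cfg) i).1.cert = some c := hc
    rw [hc]
    rfl
  sent_correct r i hi j := by
    obtain ⟨e, he⟩ := Option.ne_none_iff_exists'.1 (strong_eba_state_ne_none α hi r)
    rw [strong_sent_eq_inr α hi (by omega), he, List.filterMap_map]
    exact List.filterMap_some
  state_succ r i hi := by
    obtain ⟨e, he⟩ := Option.ne_none_iff_exists'.1 (strong_eba_state_ne_none α hi r)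
    rw [← add_assoc, strong_eba_state_succ α hi (by omega), he]
    rfl
  unforgeable r i hi j m hm s hs hsB := by
    obtain ⟨m', hm', hmm⟩ := List.mem_filterMap.1 hm
    obtain ⟨r', hr', j', m₂, hm₂, hs₂⟩ := α.unforgeable (ebaStart cfg + r) i hi j (Sum.inr m)
      (by cases m' with
        | inl m' => simp at hmm
        | inr m' => cases hmm; exact hm')
      ⟨s.signer, Sum.inr s.content⟩ ⟨s, hs, rfl⟩ hsB
    -- Separate keys: what correct processes send before EBA carries only signatures tagged
    -- `Sum.inl`, so an EBA signature must stem from a round of EBA itself.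
    have hle : ebaStart cfg ≤ r' := by
      by_contra hlt
      rw [strong_sent_eq_inl α hsB (by omega)] at hm₂
      obtain ⟨m₃, -, rfl⟩ := List.mem_map.1 hm₂
      obtain ⟨p, -, hp⟩ := hs₂
      exact Sum.inl_ne_inr (congrArg PSig.content hp)
    refine ⟨r' - ebaStart cfg, by omega, j', ?_⟩
    rw [Nat.add_sub_cancel' hle]
    rcases m₂ with m₂ | m₂
    · obtain ⟨p, -, hp⟩ := hs₂
      exact absurd (congrArg PSig.content hp) Sum.inl_ne_inr
    · obtain ⟨p, hp, hps⟩ := hs₂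
      have : p = s := by
        have h1 : p.signer = s.signer := (PSig.mk.inj hps).1
        have h2 : p.content = s.content := Sum.inr_injective (PSig.mk.inj hps).2
        cases p; cases s
        cases h1; cases h2
        rfl
      exact ⟨m₂, List.mem_filterMap.2 ⟨_, hm₂, rfl⟩, this ▸ hp⟩

theorem strong_wordsBefore (R : ℕ) :
    α.wordsBefore (ebaStart cfg + R) =
      ∑ r ∈ Finset.range (ebaStart cfg), (strongLocalRun α).roundWords r +
        (strongEBA α).wordsBefore R := by
  rw [Execution.wordsBefore, Finset.sum_range_add]
  congr 1
  · refine Finset.sum_congr rfl fun r hr => Finset.sum_congr rfl fun i hi =>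
      Finset.sum_congr rfl fun j _ => ?_
    rw [Finset.mem_range] at hr
    rw [Finset.mem_compl] at hi
    rw [strong_sent_eq_inl α hi hr, (strongLocalRun α).sent_eq r hr i hi]
    exact congrArg List.sum List.map_map
  · refine Finset.sum_congr rfl fun r hr => Finset.sum_congr rfl fun i hi =>
      Finset.sum_congr rfl fun j _ => ?_
    rw [Finset.mem_compl] at hi
    obtain ⟨e, he⟩ := Option.ne_none_iff_exists'.1 (strong_eba_state_ne_none α hi r)
    have hst : (strongEBA α).state r i = e := by
      change Option.getD (α.state (ebaStart cfg + r) i).2 _ = e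
      rw [he]
      rfl
    rw [(strongEBA α).sent_correct r i hi, strong_sent_eq_inr α hi (by omega), he, hst]
    exact congrArg List.sum List.map_map

theorem Execution.wordsBefore_le_wordComplexity {In Out : Type u} {P : Protocol n In Out}
    (β : Execution P B) {Legal : In → Prop} (h : ∀ i, i ∉ B → Legal (β.input i)) (R : ℕ) :
    (β.wordsBefore R : ℕ∞) ≤ P.wordComplexity Legal B.card :=
  (le_iSup (fun R : ℕ => (β.wordsBefore R : ℕ∞)) R).trans
    (le_iSup₂_of_le B rfl (le_iSup₂_of_le β h le_rfl))

theorem Execution.wordsBefore_mono {In Out : Type u} {P : Protocol n In Out}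
    (β : Execution P B) : Monotone β.wordsBefore := fun _ _ h =>
  Finset.sum_le_sum_of_subset (Finset.range_mono h)

theorem valid_strongEBA_input (hn : 2 * cfg.t + 1 + cfg.tO ≤ n) (hn3 : n ≤ 3 * cfg.t + 1)
    (hB : B.card ≤ cfg.t) (h : B.card ≤ cfg.tO ∨ cfg.relay = true) (hi : i ∉ B) :
    Valid cfg.t ((strongEBA α).input i) := by
  obtain ⟨c, hc⟩ := Option.ne_none_iff_exists'.1 ((strongLocalRun α).cert_ebaStart_ne_none hi)
  have hv := (strongLocalRun α).valid_ebaStart hn hn3 hB h hi hc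
  replace hc : (α.state (ebaStart cfg) i).1.cert = some c := hc
  change Valid cfg.t (Option.getD (α.state (ebaStart cfg) i).1.cert _)
  rw [hc]
  exact hv

/-- The word complexity of STRONG, in terms of that of EBA. -/
theorem strong_wordComplexity_le (hn : 2 * cfg.t + 1 + cfg.tO ≤ n) (hn3 : n ≤ 3 * cfg.t + 1)
    {K D f : ℕ} (hf : f ≤ cfg.t) (hD : cfg.tO < f → n ≤ D * (f + 1))
    (hE : E.wordComplexity (Valid cfg.t) f ≤ (K * n * (f + 1) : ℕ))
    (hE' : cfg.relay = true ∨ E.wordComplexity (fun _ => True) f ≤ (K * n ^ 2 : ℕ)) :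
    (strong cfg E).wordComplexity (fun _ => True) f ≤
      ((324 + 72 * (D + 1) + K * (D + 1)) * n * (f + 1) : ℕ) := by
  refine iSup₂_le fun B hBf => iSup₂_le fun α _ => iSup_le fun R => ?_
  subst hBf
  have h1 := (strongLocalRun α).sum_ebaStart_le hn hn3 hD
  have h2 : (strongEBA α).wordsBefore R ≤ K * n * ((D + 1) * (B.card + 1)) := by
    by_cases h : B.card ≤ cfg.tO ∨ cfg.relay = true
    · have := ((strongEBA α).wordsBefore_le_wordComplexity
        (fun i hi => valid_strongEBA_input α hn hn3 hf h hi) R).trans hE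
      refine (Nat.cast_le.1 this).trans (Nat.mul_le_mul_left _ ?_)
      exact Nat.le_mul_of_pos_left _ (by omega)
    -- Here the inputs may be invalid, but `n ≤ D * (f + 1)` turns the quadratic bound into the
    -- desired one.
    · rw [not_or, not_le] at h
      have := ((strongEBA α).wordsBefore_le_wordComplexity (fun i _ => trivial) R).trans
        (hE'.resolve_left h.2)
      refine (Nat.cast_le.1 this).trans ?_
      rw [pow_two, ← mul_assoc]
      exact Nat.mul_le_mul_left _ ((hD h.1).trans (Nat.mul_le_mul_right _ (by omega)))
  -- Extending the horizon by `ebaStart cfg` rounds only adds words and makes the splitting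
  -- applicable to every `R`.
  refine Nat.cast_le.2 ((α.wordsBefore_mono (Nat.le_add_left R (ebaStart cfg))).trans ?_)
  rw [strong_wordsBefore]
  linarith

end Strong

/-! ### Arithmetic of the number of processes and the optimistic threshold. -/

theorem numProcs_le {c : ℝ} (hc1 : c ≤ 1) (t : ℕ) :
    numProcs c t ≤ 3 * t + 1 := by
  have : ⌈c * t⌉₊ ≤ t := Nat.ceil_le.2 (mul_le_of_le_one_left t.cast_nonneg hc1)
  unfold numProcs
  omega

theorem le_numProcs (c : ℝ) (t : ℕ) : 2 * t + 1 + optThreshold c t ≤ numProcs c t :=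
  Nat.add_le_add_left (Nat.floor_le_ceil _) _

/-- From `⌊c t⌋ < f` follows `c t < f`, hence `t ≤ ⌈c⁻¹⌉ f`, and `n ≤ 3t + 1`. -/
theorem numProcs_le_of_optThreshold_lt {c : ℝ} (hc0 : 0 < c) (hc1 : c ≤ 1) {t f : ℕ}
    (h : optThreshold c t < f) : numProcs c t ≤ (3 * ⌈c⁻¹⌉₊ + 1) * (f + 1) := by
  have h1 : c * t < f := (Nat.floor_lt (by positivity)).1 h
  have h2 : (t : ℝ) ≤ ⌈c⁻¹⌉₊ * f := by
    calc (t : ℝ) = c⁻¹ * (c * t) := by field_simp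
      _ ≤ ⌈c⁻¹⌉₊ * f := mul_le_mul (Nat.le_ceil _) h1.le (by positivity) (by positivity)
  have h3 : t ≤ ⌈c⁻¹⌉₊ * f := by exact_mod_cast h2
  have h4 := numProcs_le hc1 t
  linarith [Nat.zero_le f, Nat.zero_le ⌈c⁻¹⌉₊]

end SBA

theorem mainTheorem2 (c : ℝ) (hc0 : 0 < c) (hc1 : c ≤ 1) (K : ℕ) :
    ∃ C : ℕ, ∀ (t : ℕ) (V : Type*) [LinearOrder V] [BoundedOrder V] (defaultValue : V)
      (relay : Bool) (E : SBA.EBAProtocol (SBA.numProcs c t) V),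
      (∀ f ≤ t, E.wordComplexity (SBA.Valid t) f ≤ (K * SBA.numProcs c t * (f + 1) : ℕ)) →
      (relay = true ∨
        ∀ f ≤ t, E.wordComplexity (fun _ => True) f ≤ (K * SBA.numProcs c t ^ 2 : ℕ)) →
      ∀ f ≤ t,
        (SBA.strong ⟨t, SBA.optThreshold c t, defaultValue, relay⟩ E).wordComplexity
          (fun _ => True) f ≤ (C * SBA.numProcs c t * (f + 1) : ℕ) :=
  -- Unification gives `C = 324 + 72 * (D + 1) + K * (D + 1)` with `D = 3 * ⌈c⁻¹⌉₊ + 1`, which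
  -- depends only on `c` and `K`.
  ⟨_, fun t _ _ _ defaultValue relay _ hE hE' f hf =>
    SBA.strong_wordComplexity_le (cfg := ⟨t, SBA.optThreshold c t, defaultValue, relay⟩)
      (SBA.le_numProcs c t) (SBA.numProcs_le hc1 t) hf
      (SBA.numProcs_le_of_optThreshold_lt hc0 hc1) (hE f hf) (hE'.imp_right fun h => h f hf)⟩
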